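/- Let $S$ be a planar diagram of an oriented singular link (for instance a singular knot) with $n$ transversal double points and no other crossings; it represents a self-intersection of codimension $n$ of the discriminant of the space of knots. For a set $A$ of double points let $D_A$ be the link diagram in which the double points in $A$ are resolved to negative crossings (undercrossings) and the others to positive crossings (overcrossings). The $2^n$ diagrams $D_A$ represent the knots or links in the chambers adjacent to the self-intersection; along the coorientation of the discriminant an overcrossing becomes an undercrossing, so $D_\emptyset$ is the first vertex and $D_{\mathrm{all}}$ the last one. Let $C(D)=C^{i,j}(D)$ be the bigraded Khovanov complex of $D$ over $\mathbb Z$, where $i$ is the number of 1-resolutions minus the number of negative crossings and $j$ is the usual quantum degree. For a bigraded complex $C$ let $(C^{*})^{i,j}=\operatorname{Hom}(C^{-i,-j},\mathbb Z)$ be its dual, and let $C\{k\}^{i,j}=C^{i,j-k}$. The complexes $C(D_A)\{2|A|\}$ and the wall-crossing morphisms (for a crossing change, up to sign the identity from the part of the complex where the crossing is 0-resolved onto the part where the changed crossing is 1-resolved, which consists of the same planar smoothings, and zero on the rest) form a commutative $n$-dimensional cube. Then: (1) Each of the $2^n$ complexes of the cube has length at most $n+1$: the one at $A$ is zero outside the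 homological degrees $-|A|\le i\le n-|A|$. (2) The last complex is the dual of the first one: $C(D_{\mathrm{all}})\cong C(D_\emptyset)^{*}$ as bigraded complexes. In the cube, where the last complex is shifted by $2n$ in the quantum degree, the vertex at $A=\mathrm{all}$ is isomorphic to the dual of the vertex at $A=\emptyset$, shifted by $\{2n\}$. (3) More generally, for every $A$ with complement $A^{c}$ (so that all crossings are changed): the diagram $D_{A^{c}}$ is the mirror image of $D_A$; at each crossing a planar smoothing is the 0-resolution for $D_{A^{c}}$ if and only if it is the 1-resolution for $D_A$; and $C(D_{A^{c}})\cong C(D_A)^{*}$ as bigraded complexes. -/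

import Mathlib

open CategoryTheory

set_option linter.unusedSectionVars false
set_option linter.unusedSimpArgs false
set_option linter.unusedVariables false

namespace Khovanov

/-- Left or right. At a double point both strands are drawn pointing upwards, so that each double point
has four corners: bottom left and bottom right (where the two strands come in), top left and top
right (where they go out). The strand coming in at the bottom left goes out at the top right, and
the strand coming in at the bottom right goes out at the top left. -/
inductive Side
  | left
  | right
  deriving DecidableEq

instance : Fintype Side := ⟨{.left, .right}, fun s => by cases s <;> decide⟩

/-- A flat oriented link projection with `n` transversal double points, as a combinatorial map.
An arc is named by the corner where it leaves a double point: `(c, s)` is the arc going out of the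
double point `c` at the top on side `s`, and it arrives at `(next (c, s)).1` from below, on the
side `(next (c, s)).2`. There are also `loops` closed components without double points. -/
structure Projection (n : ℕ) where
  next : Fin n × Side ≃ Fin n × Side
  loops : ℕ

namespace Projection

variable {n : ℕ} (P : Projection n)

/-- The pieces of the projection: arcs between double points, and components without double points. -/
abbrev Strand : Type := (Fin n × Side) ⊕ Fin P.loops

/-- The arc that goes out of the double point `c` on side `s`. -/
def out (c : Fin n) (s : Side) : P.Strand := Sum.inl (c, s)

/-- The arc that comes into the double point `c` on side `s`. -/
def inc (c : Fin n) (s : Side) : P.Strand := Sum.inl (P.next.symm (c, s))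

/-- `(a, s)` is the side `s` of the arc `a`. Two sides of arcs are adjacent if they bound the same
one of the four sectors (west, south, east, north) at a double point. -/
inductive CornerRel : (Fin n × Side) × Side → (Fin n × Side) × Side → Prop
  | west (c : Fin n) :
      CornerRel (P.next.symm (c, .left), .left) ((c, .left), .left)
  | south (c : Fin n) :
      CornerRel (P.next.symm (c, .left), .right) (P.next.symm (c, .right), .left)
  | east (c : Fin n) :
      CornerRel (P.next.symm (c, .right), .right) ((c, .right), .right)
  | north (c : Fin n) :
      CornerRel ((c, .left), .right) ((c, .right), .left)

/-- Faces (regions) of the projection: the boundary cycles formed by the sides of arcs. -/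
def Face : Type := Quotient (Relation.EqvGen.setoid P.CornerRel)

/-- Double points joined by an arc. -/
inductive AdjRel : Fin n → Fin n → Prop
  | arc (a : Fin n × Side) : AdjRel a.1 (P.next a).1

/-- Connected components of the 4-valent graph formed by the double points. -/
def Component : Type := Quotient (Relation.EqvGen.setoid P.AdjRel)

/-- Planarity through the Euler characteristic: each connected component of the graph, with `n`
vertices, `2 n` edges and the faces above altogether, lies on a sphere, that is
`n - 2 n + #faces = 2 #components`. -/
def Planar : Prop := Nat.card P.Face = n + 2 * Nat.card P.Component

/-- A planar smoothing `σ` replaces each double point `c` by two arcs: if `σ c = false`, the oriented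
smoothing `) (` (each incoming arc is joined to the outgoing arc on the same side); if `σ c = true`,
the other smoothing (the two incoming arcs are joined, and so are the two outgoing ones).
`JoinRel σ` lists the strands that are joined at double points. -/
inductive JoinRel (σ : Fin n → Bool) : P.Strand → P.Strand → Prop
  | oriented (c : Fin n) (s : Side) (h : σ c = false) : JoinRel σ (P.inc c s) (P.out c s)
  | lower (c : Fin n) (h : σ c = true) : JoinRel σ (P.inc c .left) (P.inc c .right)
  | upper (c : Fin n) (h : σ c = true) : JoinRel σ (P.out c .left) (P.out c .right)

/-- Strands lying on the same circle of the smoothing `σ`. -/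
def conn (σ : Fin n → Bool) : Setoid P.Strand := Relation.EqvGen.setoid (P.JoinRel σ)

/-! ### Planar projections have a checkerboard colouring -/

theorem card_side : Fintype.card Side = 2 := rfl

theorem sum_side {M : Type*} [AddCommMonoid M] (f : Side → M) : ∑ s, f s = f .left + f .right := by
  have : (Finset.univ : Finset Side) = {.left, .right} := rfl
  rw [this, Finset.sum_pair (by decide)]

theorem finrank_ker_le {V W U : Type*} [AddCommGroup V] [Module (ZMod 2) V]
    [AddCommGroup W] [Module (ZMod 2) W] [AddCommGroup U] [Module (ZMod 2) U]
    [FiniteDimensional (ZMod 2) V] [FiniteDimensional (ZMod 2) U]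
    (f : V →ₗ[ZMod 2] W) (e : V →ₗ[ZMod 2] U) (h : ∀ v, f v = 0 → e v = 0 → v = 0) :
    Module.finrank (ZMod 2) V ≤
      Module.finrank (ZMod 2) (LinearMap.range f) + Module.finrank (ZMod 2) U := by
  rw [← LinearMap.finrank_range_add_finrank_ker f]
  gcongr
  refine LinearMap.finrank_le_finrank_of_injective (f := e.comp (LinearMap.ker f).subtype) ?_
  rw [← LinearMap.ker_eq_bot, LinearMap.ker_eq_bot']
  rintro ⟨v, hv⟩ hv'
  ext
  exact h v hv hv'

theorem checkerboard (hP : P.Planar) : ∃ κ : Fin n × Side → ZMod 2,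
    (∀ a, κ (P.next a) = κ a) ∧ ∀ c, κ (c, .right) = κ (c, .left) + 1 := by
  classical
  let Q : (Fin n × Side) × Side → P.Face := Quotient.mk _
  have hQ : ∀ {x y}, P.CornerRel x y → Q x = Q y := fun h =>
    Quotient.sound (Relation.EqvGen.rel _ _ h)
  let K : Fin n → P.Component := Quotient.mk _
  have : Finite P.Face := Quotient.finite _
  have : Finite P.Component := Quotient.finite _
  have : Fintype P.Face := Fintype.ofFinite _
  have : Fintype P.Component := Fintype.ofFinite _
  have hE : Fintype.card P.Face = n + 2 * Fintype.card P.Component := by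
    simpa [Planar] using hP
  have hK : ∀ g : Fin n → ZMod 2, (∀ a : Fin n × Side, g a.1 = g (P.next a).1) →
      (∀ k : P.Component, g k.out = 0) → g = 0 := by
    intro g hg h0
    have key : ∀ a b, Relation.EqvGen P.AdjRel a b → g a = g b := by
      intro a b h
      induction h with
      | rel x y h => cases h with | arc a => exact hg a
      | refl => rfl
      | symm _ _ _ ih => exact ih.symm
      | trans _ _ _ _ _ ih1 ih2 => exact ih1.trans ih2
    funext c
    have : Relation.EqvGen P.AdjRel (K c).out c := Quotient.mk_out (s := Relation.EqvGen.setoid P.AdjRel) c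
    rw [← key _ _ this, h0]; rfl
  let D : (P.Face → ZMod 2) →ₗ[ZMod 2] (Fin n × Side → ZMod 2) :=
    { toFun := fun f a => f (Q (a, .left)) + f (Q (a, .right))
      map_add' := by intros; ext; simp; ring
      map_smul' := by intros; ext; simp; ring }
  have z2 : ∀ x y : ZMod 2, x + y = 0 → x = y := by decide
  have z2' : ∀ x : ZMod 2, x + x = 0 := by decide
  have h1 := finrank_ker_le D
    (U := P.Component → ZMod 2)
    { toFun := fun f k => f (Q ((k.out, .left), .left))
      map_add' := by intros; rfl
      map_smul' := by intros; rfl } (by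
      intro f hf h0
      have hf' : ∀ a, f (Q (a, .left)) = f (Q (a, .right)) := fun a => z2 _ _ (congrFun hf a)
      have e1 : ∀ c, f (Q ((c, .right), .left)) = f (Q ((c, .left), .left)) := fun c => by
        rw [← hQ (.north c), hf']
      have e2 : ∀ a : Fin n × Side, f (Q (a, .left)) = f (Q ((a.1, .left), .left)) := by
        rintro ⟨c, _ | _⟩
        · rfl
        · exact e1 c
      have e3 : (fun c => f (Q ((c, .left), .left))) = 0 := by
        refine hK _ ?_ (fun k => congrFun h0 k)
        intro a
        obtain ⟨b, rfl⟩ := P.next.symm.surjective a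
        obtain ⟨c, _ | _⟩ := b
        · simp only [Equiv.apply_symm_apply]
          rw [← e2, hQ (.west c)]
        · simp only [Equiv.apply_symm_apply]
          rw [← e2, hf', hQ (.east c), ← hf', e1]
      funext q
      obtain ⟨⟨a, s⟩, rfl⟩ := Quotient.exists_rep q
      change f (Q (a, s)) = 0
      have : f (Q (a, s)) = f (Q (a, .left)) := by
        cases s
        · rfl
        · exact (hf' a).symm
      rw [this, e2]
      exact congrFun e3 a.1)
  let B : Matrix (Fin n) (Fin n × Side) (ZMod 2) := fun c a =>
    (if a.1 = c then 1 else 0) + (if (P.next a).1 = c then 1 else 0)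
  have hBt : ∀ g a, B.transpose.mulVec g a = g a.1 + g (P.next a).1 := by
    intro g a
    change ∑ c, ((if a.1 = c then 1 else 0) + (if (P.next a).1 = c then 1 else 0)) * g c = _
    simp [add_mul, Finset.sum_add_distrib]
  have hB : ∀ z c, B.mulVec z c = (z (c, .left) + z (c, .right)) +
      (z (P.next.symm (c, .left)) + z (P.next.symm (c, .right))) := by
    intro z c
    simp only [Matrix.mulVec, dotProduct, B, add_mul, Finset.sum_add_distrib]
    congr 1
    · rw [Fintype.sum_prod_type, Finset.sum_eq_single c] <;> simp +contextual [sum_side]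
    · rw [← P.next.symm.sum_comp, Fintype.sum_prod_type, Finset.sum_eq_single c] <;>
        simp +contextual [sum_side]
  have h2 := finrank_ker_le B.transpose.mulVecLin
    (U := P.Component → ZMod 2)
    { toFun := fun f k => f k.out
      map_add' := by intros; rfl
      map_smul' := by intros; rfl } (by
      intro g hg h0
      refine hK g ?_ (fun k => congrFun h0 k)
      intro a
      have := congrFun hg a
      rw [Matrix.mulVecLin_apply, hBt] at this
      exact z2 _ _ this)
  have h3 := LinearMap.finrank_range_add_finrank_ker B.mulVecLin
  have h4 : Module.finrank (ZMod 2) (LinearMap.range B.transpose.mulVecLin) =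
      Module.finrank (ZMod 2) (LinearMap.range B.mulVecLin) := Matrix.rank_transpose B
  have h5 : LinearMap.range D ≤ LinearMap.ker B.mulVecLin := by
    rintro _ ⟨f, rfl⟩
    rw [LinearMap.mem_ker]
    funext c
    rw [Matrix.mulVecLin_apply, hB]
    change (f (Q _) + f (Q _) + (f (Q _) + f (Q _))) +
      (f (Q _) + f (Q _) + (f (Q _) + f (Q _))) = 0
    rw [hQ (.west c), hQ (.south c), hQ (.east c), hQ (.north c)]
    generalize f _ = x1
    generalize f _ = x2
    generalize f _ = x3
    generalize f _ = x4
    revert x1 x2 x3 x4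
    decide
  have h6 : LinearMap.range D = LinearMap.ker B.mulVecLin := by
    apply Submodule.eq_of_le_of_finrank_le h5
    simp only [Module.finrank_fintype_fun_eq_card, Fintype.card_prod, Fintype.card_fin,
      card_side] at h1 h2 h3
    omega
  have h7 : (fun _ => 1) ∈ LinearMap.range D := by
    rw [h6, LinearMap.mem_ker]
    funext c
    rw [Matrix.mulVecLin_apply, hB]
    exact (by decide : (1 + 1 + (1 + 1) : ZMod 2) = 0)
  obtain ⟨f, hf⟩ := h7
  have hf' : ∀ a, f (Q (a, .right)) = f (Q (a, .left)) + 1 := by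
    intro a
    have := congrFun hf a
    change f (Q _) + f (Q _) = 1 at this
    revert this
    generalize f _ = x
    generalize f _ = y
    revert x y
    decide
  refine ⟨fun a => f (Q (a, .left)), ?_, ?_⟩
  · intro a
    obtain ⟨b, rfl⟩ := P.next.symm.surjective a
    obtain ⟨c, _ | _⟩ := b
    · simp only [Equiv.apply_symm_apply]
      rw [hQ (.west c)]
    · simp only [Equiv.apply_symm_apply]
      have := congrArg f (hQ (.east c))
      rw [hf', hf'] at this
      exact (add_right_cancel this).symm
  · intro c
    change f (Q _) = f (Q _) + 1
    rw [← hQ (.north c), hf']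

end Projection

noncomputable section
open scoped Classical

/-! ### Merging and splitting maps, and their commutation -/

section Frobenius
variable {A : Type} [Finite A]

instance quotientFintype (r : Setoid A) : Fintype (Quotient r) := Fintype.ofFinite _

/-- Degree of a basis vector of `V ⊗ ... ⊗ V`, one factor for each class (circle) of `r`. The basis
vector is given by its labels: `true` is `v₊`, of degree `1`, and `false` is `v₋`, of degree `-1`. -/
def labelDegree {r : Setoid A} (x : Quotient r → Bool) : ℤ := ∑ K, if x K then 1 else -1

/-- Pairs of basis vectors `x`, `y` such that `y` occurs (with coefficient `1`) in the image of `x`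
under the merging map `v₊⊗v₊ ↦ v₊`, `v₊⊗v₋, v₋⊗v₊ ↦ v₋`, `v₋⊗v₋ ↦ 0` or the splitting map
`v₊ ↦ v₊⊗v₋ + v₋⊗v₊`, `v₋ ↦ v₋⊗v₋`: the labels agree on all strands outside the circles that are
merged or split (the strands in `T`), and the degree drops by one. -/
def EdgeRel {r r' : Setoid A} (T : A → Prop) (x : Quotient r → Bool) (y : Quotient r' → Bool) :
    Prop :=
  (∀ a, ¬ T a → x (Quotient.mk r a) = y (Quotient.mk r' a)) ∧ labelDegree y = labelDegree x - 1

/-- `r'` arises from `r` by merging the two different circles through `p` and `u`. -/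
def Merges (r r' : Setoid A) (p u : A) : Prop :=
  ¬ r p u ∧ ∀ a b, r' a b ↔ r a b ∨ (r a p ∧ r u b) ∨ (r a u ∧ r p b)

theorem Merges.left {r r' : Setoid A} {p u : A} (h : Merges r r' p u) (a : A) :
    r' a p ↔ r a p ∨ r a u := by
  rw [h.2]
  constructor
  · rintro (h | h | h)
    · exact .inl h
    · exact .inl h.1
    · exact .inr h.1
  · rintro (h | h)
    · exact .inl h
    · exact .inr (.inr ⟨h, r.refl _⟩)

theorem Merges.sum_eq {r r' : Setoid A} {p u : A} (h : Merges r r' p u)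
    (g : Quotient r → ℤ) (k : Quotient r' → ℤ)
    (H : ∀ a, ¬ r' a p → g (Quotient.mk r a) = k (Quotient.mk r' a)) :
    ∑ K, g K - g (Quotient.mk r p) - g (Quotient.mk r u) = ∑ K, k K - k (Quotient.mk r' p) := by
  have hpu : Quotient.mk r p ≠ Quotient.mk r u := fun e => h.1 (Quotient.exact e)
  have e1 : ∑ K, g K - g (Quotient.mk r p) - g (Quotient.mk r u) =
      ∑ K ∈ (Finset.univ.erase (Quotient.mk r p)).erase (Quotient.mk r u), g K := by
    rw [← Finset.add_sum_erase Finset.univ g (Finset.mem_univ (Quotient.mk r p)),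
      ← Finset.add_sum_erase (Finset.univ.erase (Quotient.mk r p)) g
        (Finset.mem_erase.2 ⟨hpu.symm, Finset.mem_univ (Quotient.mk r u)⟩)]
    ring
  have e2 : ∑ K, k K - k (Quotient.mk r' p) = ∑ K ∈ Finset.univ.erase (Quotient.mk r' p), k K := by
    rw [← Finset.add_sum_erase Finset.univ k (Finset.mem_univ (Quotient.mk r' p))]
    ring
  rw [e1, e2]
  refine Finset.sum_bij (fun K _ => Quotient.map (sa := r) (sb := r') id (fun a b hab => (h.2 a b).2 (.inl hab)) K) ?_ ?_ ?_ ?_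
  · intro K hK
    induction K using Quotient.inductionOn with | h a => ?_
    simp only [Finset.mem_erase, Finset.mem_univ, and_true, ne_eq, Quotient.map_mk, id] at hK ⊢
    intro e
    rcases (h.left a).1 (Quotient.exact e) with e | e
    · exact hK.2 (Quotient.sound e)
    · exact hK.1 (Quotient.sound e)
  · intro K hK K' hK' e
    induction K using Quotient.inductionOn with | h a => ?_
    induction K' using Quotient.inductionOn with | h b => ?_
    simp only [Finset.mem_erase, Finset.mem_univ, and_true, ne_eq, Quotient.map_mk, id] at hK hK' e
    rcases (h.2 a b).1 (Quotient.exact e) with e | e | e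
    · exact Quotient.sound e
    · exact (hK.2 (Quotient.sound e.1)).elim
    · exact (hK.1 (Quotient.sound e.1)).elim
  · intro K hK
    induction K using Quotient.inductionOn with | h a => ?_
    refine ⟨Quotient.mk r a, ?_, rfl⟩
    simp only [Finset.mem_erase, Finset.mem_univ, and_true, ne_eq] at hK ⊢
    constructor
    · intro e; exact hK (Quotient.sound ((h.left a).2 (.inr (Quotient.exact e))))
    · intro e; exact hK (Quotient.sound ((h.left a).2 (.inl (Quotient.exact e))))
  · intro K hK
    induction K using Quotient.inductionOn with | h a => ?_
    refine H a ?_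
    simp only [Finset.mem_erase, Finset.mem_univ, and_true, ne_eq] at hK
    intro e
    rcases (h.left a).1 e with e | e
    · exact hK.2 (Quotient.sound e)
    · exact hK.1 (Quotient.sound e)

/-- The degree of a label. -/
def val (b : Bool) : ℤ := if b then 1 else -1

theorem Merges.degree_eq {r r' : Setoid A} {p u : A} (h : Merges r r' p u)
    (x : Quotient r → Bool) (y : Quotient r' → Bool)
    (H : ∀ a, ¬ r' a p → x (Quotient.mk r a) = y (Quotient.mk r' a)) :
    labelDegree x - val (x (Quotient.mk r p)) - val (x (Quotient.mk r u)) =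
      labelDegree y - val (y (Quotient.mk r' p)) :=
  h.sum_eq (fun K => val (x K)) (fun K => val (y K)) (fun a ha => by rw [H a ha])

theorem Merges.card {r r' : Setoid A} {p u : A} (h : Merges r r' p u) :
    Fintype.card (Quotient r) = Fintype.card (Quotient r') + 1 := by
  have := h.sum_eq (fun _ => 1) (fun _ => 1) (fun _ _ => rfl)
  simp at this
  omega

theorem degree_update {r : Setoid A} (x : Quotient r → Bool) (K : Quotient r) (b : Bool) :
    labelDegree (Function.update x K b) = labelDegree x + val b - val (x K) := by
  unfold labelDegree
  rw [← Finset.add_sum_erase _ _ (Finset.mem_univ K), ← Finset.add_sum_erase Finset.univ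
    (fun K => if x K = true then (1 : ℤ) else -1) (Finset.mem_univ K), Function.update_self]
  have : ∑ x_1 ∈ Finset.univ.erase K, (if Function.update x K b x_1 = true then (1 : ℤ) else -1) =
      ∑ x_1 ∈ Finset.univ.erase K, (if x x_1 = true then (1 : ℤ) else -1) := by
    refine Finset.sum_congr rfl fun L hL => ?_
    rw [Function.update_of_ne (Finset.ne_of_mem_erase hL)]
  rw [this]
  unfold val
  ring

/-- Passing from `r` to `r'` merges two circles or splits one; `T` are the strands on them. -/
structure Bif (r r' : Setoid A) (p u : A) (T : A → Prop) : Prop where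
  merges : Merges r r' p u ∨ Merges r' r p u
  touch : ∀ a, T a ↔ r a p ∨ r a u

theorem Bif.touch' {r r' : Setoid A} {p u : A} {T : A → Prop} (h : Bif r r' p u T) (a : A) :
    T a ↔ r' a p ∨ r' a u := by
  rw [h.touch]
  have key : ∀ {s s' : Setoid A}, Merges s s' p u → (s a p ∨ s a u ↔ s' a p ∨ s' a u) := by
    intro s s' h
    have h1 : s' p u := (h.2 _ _).2 (.inr (.inl ⟨s.refl _, s.refl _⟩))
    rw [← h.left]
    exact ⟨.inl, fun e => e.elim id fun e => s'.trans e (s'.symm h1)⟩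
  rcases h.merges with h | h
  · exact key h
  · exact (key h).symm

theorem Bif.symm {r r' : Setoid A} {p u : A} {T : A → Prop} (h : Bif r r' p u T) :
    Bif r' r p u T := ⟨h.merges.symm, h.touch'⟩

/-- multiplication by the generator of the circle through `a` -/
def mulX {r : Setoid A} (a : A) (g : (Quotient r → Bool) → ℤ) : (Quotient r → Bool) → ℤ :=
  fun z => if z (Quotient.mk r a) = false then g (Function.update z (Quotient.mk r a) true) else 0

/-- The image of the basis vector `x` under an edge map. -/
def edge {r r' : Setoid A} (T : A → Prop) (x : Quotient r → Bool) : (Quotient r' → Bool) → ℤ :=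
  fun y => if EdgeRel T x y then 1 else 0

theorem update_agree {r r' : Setoid A} {T : A → Prop} {x : Quotient r → Bool}
    {y : Quotient r' → Bool} {a : A} (ha : T a)
    (hr : ∀ b, r a b → T b) (hr' : ∀ b, r' a b → T b) (b c : Bool) :
    (∀ e, ¬ T e → Function.update x (Quotient.mk r a) b (Quotient.mk r e) =
      Function.update y (Quotient.mk r' a) c (Quotient.mk r' e)) ↔
    (∀ e, ¬ T e → x (Quotient.mk r e) = y (Quotient.mk r' e)) := by
  refine forall₂_congr fun e he => ?_
  rw [Function.update_of_ne, Function.update_of_ne]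
  · intro h; exact he (hr' _ (r'.symm (Quotient.exact h)))
  · intro h; exact he (hr _ (r.symm (Quotient.exact h)))

theorem Bif.intertwine {r r' : Setoid A} {p u : A} {T : A → Prop} (h : Bif r r' p u T)
    (x : Quotient r → Bool) (a : A) (hx : x (Quotient.mk r a) = true) :
    edge (r' := r') T (Function.update x (Quotient.mk r a) false) = mulX a (edge T x) := by
  funext z
  unfold edge mulX
  rw [← ite_and]
  congr 1
  rw [eq_iff_iff]
  unfold EdgeRel
  rw [degree_update, degree_update, hx]
  by_cases ha : T a
  · have hr : ∀ b, r a b → T b := fun b hb => by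
      rw [h.touch] at ha ⊢
      exact ha.imp (r.trans (r.symm hb)) (r.trans (r.symm hb))
    have hr' : ∀ b, r' a b → T b := fun b hb => by
      rw [h.touch'] at ha ⊢
      exact ha.imp (r'.trans (r'.symm hb)) (r'.trans (r'.symm hb))
    have e1 := update_agree (x := x) (y := z) ha hr hr' false (z (Quotient.mk r' a))
    rw [Function.update_eq_self] at e1
    have e2 := update_agree (x := x) (y := z) ha hr hr' (x (Quotient.mk r a)) true
    rw [Function.update_eq_self] at e2
    rw [e1, e2]
    have hT := h.touch a
    have hT' := h.touch' a
    rcases h.merges with hm | hm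
    · constructor
      · rintro ⟨h1, h2⟩
        have := hm.degree_eq x z fun a ha => h1 a (by rw [h.touch, ← hm.left]; exact ha)
        have e : Quotient.mk r' a = Quotient.mk r' p := Quotient.sound ((hm.left a).2 (hT.1 ha))
        rw [e]
        revert this
        rcases hT.1 ha with ea | ea
        all_goals
          have e' := Quotient.sound ea
          rw [← e', hx]
          cases z (Quotient.mk r' p) <;> simp only [val] at * <;> grind
      · rintro ⟨h0, h1, h2⟩
        refine ⟨h1, ?_⟩
        rw [h0] at h2
        simp only [val] at *; grind
    · constructor
      · rintro ⟨h1, h2⟩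
        have := hm.degree_eq z x fun a ha => (h1 a (by rw [h.touch', ← hm.left]; exact ha)).symm
        have e : Quotient.mk r a = Quotient.mk r p := Quotient.sound ((hm.left a).2 (hT'.1 ha))
        rw [← e, hx] at this
        revert this
        rcases hT'.1 ha with ea | ea
        all_goals
          have e' := Quotient.sound ea
          rw [← e']
          cases z (Quotient.mk r' a) <;> simp only [val] at * <;> grind
      · rintro ⟨h0, h1, h2⟩
        refine ⟨h1, ?_⟩
        rw [h0] at h2
        simp only [val] at *; grind
  · have hr : ∀ b, ¬ T b → (r a b ↔ r' a b) := by
      intro b hb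
      have key : ∀ {s s' : Setoid A}, Merges s s' p u → (∀ e, T e ↔ s e p ∨ s e u) →
          (s a b ↔ s' a b) := by
        intro s s' hm ht
        rw [hm.2]
        constructor
        · exact .inl
        · rintro (h | h | h)
          · exact h
          · exact (ha ((ht _).2 (.inl h.1))).elim
          · exact (ha ((ht _).2 (.inr h.1))).elim
      rcases h.merges with hm | hm
      · exact key hm h.touch
      · exact (key hm h.touch').symm
    constructor
    · rintro ⟨h1, h2⟩
      have e : z (Quotient.mk r' a) = false := by
        rw [← h1 a ha, Function.update_self]
      refine ⟨e, ?_, ?_⟩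
      · intro b hb
        by_cases hab : r a b
        · have e1 := Quotient.sound hab
          have e2 := Quotient.sound ((hr b hb).1 hab)
          rw [← e1, ← e2, Function.update_self, hx]
        · have := h1 b hb
          rw [Function.update_of_ne (fun e => hab (r.symm (Quotient.exact e)))] at this
          rw [Function.update_of_ne (fun e => hab ((hr b hb).2 (r'.symm (Quotient.exact e)))), this]
      · rw [e]; simp only [val] at *; grind
    · rintro ⟨e, h1, h2⟩
      refine ⟨?_, ?_⟩
      · intro b hb
        by_cases hab : r a b
        · have e1 := Quotient.sound hab
          have e2 := Quotient.sound ((hr b hb).1 hab)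
          rw [← e1, ← e2, Function.update_self, e]
        · have := h1 b hb
          rw [Function.update_of_ne (fun e => hab ((hr b hb).2 (r'.symm (Quotient.exact e))))] at this
          rw [Function.update_of_ne (fun e => hab (r.symm (Quotient.exact e))), this]
      · rw [e] at h2; simp only [val] at *; grind

/-- The vector `v₊ ⊗ ... ⊗ v₊`. -/
def one (r : Setoid A) : (Quotient r → Bool) → ℤ := fun z => if z = fun _ => true then 1 else 0

theorem Bif.edge_one_merge {r r' : Setoid A} {p u : A} {T : A → Prop} (h : Bif r r' p u T)
    (hm : Merges r r' p u) : edge (r := r) (r' := r') T (fun _ => true) = one r' := by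
  funext z
  unfold edge one
  congr 1
  rw [eq_iff_iff]
  unfold EdgeRel
  constructor
  · rintro ⟨h1, h2⟩
    have := hm.degree_eq (fun _ => true) z fun a ha => h1 a (by rw [h.touch, ← hm.left]; exact ha)
    have hz : z (Quotient.mk r' p) = true := by
      revert this; cases z (Quotient.mk r' p) <;> simp only [val] <;> grind
    funext K
    induction K using Quotient.inductionOn with | h a => ?_
    by_cases ha : r' a p
    · rw [Quotient.sound ha, hz]
    · exact (h1 a (by rw [h.touch, ← hm.left]; exact ha)).symm
  · rintro rfl
    refine ⟨fun _ _ => rfl, ?_⟩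
    have := hm.degree_eq (fun _ => true) (fun _ => true) (fun _ _ => rfl)
    simp only [val] at this; grind

theorem Bif.edge_one_split {r r' : Setoid A} {p u : A} {T : A → Prop} (h : Bif r r' p u T)
    (hm : Merges r' r p u) :
    edge (r := r) (r' := r') T (fun _ => true) = mulX p (one r') + mulX u (one r') := by
  funext z
  have hpu : Quotient.mk r' p ≠ Quotient.mk r' u := fun e => hm.1 (Quotient.exact e)
  have hd : (∀ a, ¬ T a → true = z (Quotient.mk r' a)) →
    labelDegree z - val (z (Quotient.mk r' p)) - val (z (Quotient.mk r' u)) =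
      labelDegree (r := r) (fun _ => true) - 1 := fun h1 =>
    hm.degree_eq z (fun _ => true) fun a ha => (h1 a (by rw [h.touch', ← hm.left]; exact ha)).symm
  have hupd : ∀ K, (Function.update z K true = fun _ => true) ↔ ∀ L, L ≠ K → z L = true := by
    intro K
    constructor
    · intro h L hL
      have := congrFun h L
      rwa [Function.update_of_ne hL] at this
    · intro h
      funext L
      by_cases hL : L = K
      · subst hL; simp
      · rw [Function.update_of_ne hL, h L hL]
  have hall : (∀ a, ¬ T a → true = z (Quotient.mk r' a)) ↔
      ∀ L, L ≠ Quotient.mk r' p → L ≠ Quotient.mk r' u → z L = true := by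
    constructor
    · intro h1 L
      induction L using Quotient.inductionOn with | h a => ?_
      intro e1 e2
      refine (h1 a ?_).symm
      rw [h.touch']
      rintro (e | e)
      · exact e1 (Quotient.sound e)
      · exact e2 (Quotient.sound e)
    · intro h1 a ha
      rw [h.touch'] at ha
      refine (h1 _ ?_ ?_).symm
      · exact fun e => ha (.inl (Quotient.exact e))
      · exact fun e => ha (.inr (Quotient.exact e))
  have hE : EdgeRel (r := r) T (fun _ => true) z ↔
      (∀ L, L ≠ Quotient.mk r' p → L ≠ Quotient.mk r' u → z L = true) ∧
        labelDegree z = labelDegree (r := r) (fun _ => true) - 1 := and_congr_left' hall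
  simp only [edge, hE, mulX, one, Pi.add_apply, hupd]
  by_cases H : ∀ L, L ≠ Quotient.mk r' p → L ≠ Quotient.mk r' u → z L = true
  · have hd' := hd (hall.2 H)
    have c1 : (∀ L, L ≠ Quotient.mk r' p → z L = true) ↔ z (Quotient.mk r' u) = true :=
      ⟨fun h => h _ hpu.symm, fun h L h1 => by
        by_cases h2 : L = Quotient.mk r' u
        · rw [h2, h]
        · exact H L h1 h2⟩
    have c2 : (∀ L, L ≠ Quotient.mk r' u → z L = true) ↔ z (Quotient.mk r' p) = true :=
      ⟨fun h => h _ hpu, fun h L h1 => by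
        by_cases h2 : L = Quotient.mk r' p
        · rw [h2, h]
        · exact H L h2 h1⟩
    simp only [c1, c2, and_iff_right H]
    have : labelDegree z = labelDegree (r := r) (fun _ => true) - 1 +
      val (z (Quotient.mk r' p)) + val (z (Quotient.mk r' u)) := by linarith
    rw [this]
    cases z (Quotient.mk r' p) <;> cases z (Quotient.mk r' u) <;> simp [val] <;> omega
  · have n1 : ¬ (∀ L, L ≠ Quotient.mk r' p → z L = true) := fun h => H fun L h1 _ => h L h1
    have n2 : ¬ (∀ L, L ≠ Quotient.mk r' u → z L = true) := fun h => H fun L _ h1 => h L h1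
    simp [n1, n2, H]

theorem mulX_add {r : Setoid A} (a : A) (f g : (Quotient r → Bool) → ℤ) :
    mulX a (f + g) = mulX a f + mulX a g := by
  funext z
  simp only [mulX, Pi.add_apply]
  split <;> simp

theorem mulX_comm {r : Setoid A} (a b : A) (f : (Quotient r → Bool) → ℤ) :
    mulX a (mulX b f) = mulX b (mulX a f) := by
  funext z
  by_cases h : Quotient.mk r a = Quotient.mk r b
  · simp only [mulX, h]
  · simp only [mulX, Function.update_of_ne h, Function.update_of_ne (Ne.symm h)]
    rw [Function.update_comm h]
    split_ifs <;> rfl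

theorem mulX_congr {r : Setoid A} {a b : A} (h : r a b) (f : (Quotient r → Bool) → ℤ) :
    mulX a f = mulX b f := by
  unfold mulX
  rw [Quotient.sound h]

/-- Matrix of a composite of two edge maps. -/
def comp₂ {r r' r'' : Setoid A} (T T' : A → Prop) (x : Quotient r → Bool) :
    (Quotient r'' → Bool) → ℤ :=
  fun z => ∑ y : Quotient r' → Bool, edge T x y * edge T' y z

theorem comp₂_intertwine {r r' r'' : Setoid A} {p u p' u' : A} {T T' : A → Prop}
    (h : Bif r r' p u T) (h' : Bif r' r'' p' u' T') (x : Quotient r → Bool) (a : A)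
    (hx : x (Quotient.mk r a) = true) :
    comp₂ (r' := r') (r'' := r'') T T' (Function.update x (Quotient.mk r a) false) =
      mulX a (comp₂ (r' := r') T T' x) := by
  funext z
  unfold comp₂
  have e : mulX a (fun z => ∑ y : Quotient r' → Bool, edge T x y * edge T' y z) z =
      ∑ y : Quotient r' → Bool, edge T x y * mulX (r := r'') a (edge T' y) z := by
    unfold mulX
    split <;> simp
  rw [e, h.intertwine x a hx]
  have l : ∀ y : Quotient r' → Bool, mulX a (edge T x) y * edge T' y z =
      if y (Quotient.mk r' a) = false then
        edge T x (Function.update y (Quotient.mk r' a) true) * edge T' y z else 0 := by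
    intro y; unfold mulX; split <;> simp
  simp only [l]
  rw [← Finset.sum_filter]
  have s : ∑ y : Quotient r' → Bool, edge T x y * mulX (r := r'') a (edge T' y) z =
      ∑ y : Quotient r' → Bool with y (Quotient.mk r' a) = true,
        edge T x y * mulX (r := r'') a (edge T' y) z := by
    rw [Finset.sum_filter]
    refine Finset.sum_congr rfl fun y _ => ?_
    split
    · rfl
    · rename_i hy
      have hy : y (Quotient.mk r' a) = false := by simpa using hy
      have : mulX (r := r'') a (edge T' y) z = 0 := by
        have e1 : y = Function.update (Function.update y (Quotient.mk r' a) true)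
            (Quotient.mk r' a) false := by
          rw [Function.update_idem, ← hy, Function.update_eq_self]
        rw [e1, h'.intertwine _ a (by simp)]
        simp [mulX]
      rw [this, mul_zero]
  rw [s]
  refine Finset.sum_bij' (fun y _ => Function.update y (Quotient.mk r' a) true)
    (fun y _ => Function.update y (Quotient.mk r' a) false) ?_ ?_ ?_ ?_ ?_
  · intro y hy; simp
  · intro y hy; simp
  · intro y hy
    simp only [Finset.mem_filter, Finset.mem_univ, true_and] at hy
    rw [Function.update_idem, ← hy, Function.update_eq_self]
  · intro y hy
    simp only [Finset.mem_filter, Finset.mem_univ, true_and] at hy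
    rw [Function.update_idem, ← hy, Function.update_eq_self]
  · intro y hy
    simp only [Finset.mem_filter, Finset.mem_univ, true_and] at hy
    rw [← h'.intertwine _ a (by simp), Function.update_idem]
    congr 2
    rw [← hy, Function.update_eq_self]

theorem comp₂_one_merge {r r' r'' : Setoid A} {p u : A} {T T' : A → Prop}
    (h : Bif r r' p u T) (hm : Merges r r' p u) :
    comp₂ (r := r) (r' := r') (r'' := r'') T T' (fun _ => true) =
      edge (r := r') T' (fun _ => true) := by
  funext z
  unfold comp₂
  rw [h.edge_one_merge hm]
  simp [one]

theorem sum_mulX_one {r' r'' : Setoid A} {p' u' : A} {T' : A → Prop}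
    (h' : Bif r' r'' p' u' T') (a : A) (z : Quotient r'' → Bool) :
    ∑ y : Quotient r' → Bool, mulX a (one r') y * edge T' y z =
      mulX (r := r'') a (edge (r := r') T' (fun _ => true)) z := by
  rw [← h'.intertwine _ a rfl]
  rw [Finset.sum_eq_single (Function.update (fun _ => true) (Quotient.mk r' a) false)]
  · simp [mulX, one]
  · intro y _ hy
    have : mulX a (one r') y = 0 := by
      unfold mulX one
      split_ifs with h1 h2
      · refine (hy ?_).elim
        rw [← h2, Function.update_idem, ← h1, Function.update_eq_self]
      · rfl
      · rfl
    rw [this, zero_mul]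
  · simp

theorem comp₂_one_split {r r' r'' : Setoid A} {p u p' u' : A} {T T' : A → Prop}
    (h : Bif r r' p u T) (h' : Bif r' r'' p' u' T') (hm : Merges r' r p u) :
    comp₂ (r := r) (r' := r') (r'' := r'') T T' (fun _ => true) =
      mulX p (edge (r := r') T' (fun _ => true)) + mulX u (edge (r := r') T' (fun _ => true)) := by
  funext z
  unfold comp₂
  rw [h.edge_one_split hm]
  simp only [Pi.add_apply, add_mul, Finset.sum_add_distrib]
  rw [sum_mulX_one h', sum_mulX_one h']

theorem Merges.le {r r' : Setoid A} {p u : A} (h : Merges r r' p u) {a b : A} (e : r a b) :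
    r' a b := (h.2 _ _).2 (.inl e)

theorem Merges.join {r r' : Setoid A} {p u : A} (h : Merges r r' p u) : r' p u :=
  (h.2 _ _).2 (.inr (.inl ⟨r.refl _, r.refl _⟩))

theorem comp₂_one_comm {r r₁ r₂ r₃ : Setoid A} {p u p' u' : A} {T₁ T₁' T₂ T₂' : A → Prop}
    (h₁ : Bif r r₁ p u T₁) (h₁' : Bif r₁ r₃ p' u' T₁') (h₂ : Bif r r₂ p' u' T₂)
    (h₂' : Bif r₂ r₃ p u T₂') :
    comp₂ (r := r) (r' := r₁) (r'' := r₃) T₁ T₁' (fun _ => true) =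
      comp₂ (r := r) (r' := r₂) (r'' := r₃) T₂ T₂' (fun _ => true) := by
  rcases h₁.merges with m₁ | m₁ <;> rcases h₁'.merges with m₁' | m₁' <;>
    rcases h₂.merges with m₂ | m₂ <;> rcases h₂'.merges with m₂' | m₂'
  all_goals first
    | (exfalso
       have := m₁.card
       have := m₁'.card
       have := m₂.card
       have := m₂'.card
       omega)
    | skip
  · rw [comp₂_one_merge h₁ m₁, comp₂_one_merge h₂ m₂, h₁'.edge_one_merge m₁',
      h₂'.edge_one_merge m₂']
  · -- merge split / merge split
    rw [comp₂_one_merge h₁ m₁, comp₂_one_merge h₂ m₂, h₁'.edge_one_split m₁',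
      h₂'.edge_one_split m₂']
    have a1 : r₃ p p' ∨ r₃ p u' := (m₁'.left p).1 (by
      have := (m₁.2 p' u').1 m₁'.join
      rw [m₁.2]
      rcases this with e | e | e
      · exact (m₂.1 e).elim
      · exact .inl (r.symm e.1)
      · exact .inr (.inl ⟨r.refl _, r.symm e.1⟩))
    have a2 : r₃ u p' ∨ r₃ u u' := (m₁'.left u).1 (by
      have := (m₁.2 p' u').1 m₁'.join
      rw [m₁.2]
      rcases this with e | e | e
      · exact (m₂.1 e).elim
      · exact .inr (.inr ⟨r.refl _, r.symm e.1⟩)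
      · exact .inl (r.symm e.1))
    have a3 : ¬ r₃ p u := m₂'.1
    rcases a1 with a1 | a1 <;> rcases a2 with a2 | a2
    · exact (a3 (r₃.trans a1 (r₃.symm a2))).elim
    · rw [mulX_congr a1, mulX_congr a2]
    · rw [mulX_congr a1, mulX_congr a2, add_comm]
    · exact (a3 (r₃.trans a1 (r₃.symm a2))).elim
  · -- merge split / split merge
    rw [comp₂_one_merge h₁ m₁, comp₂_one_split h₂ h₂' m₂, h₁'.edge_one_split m₁',
      h₂'.edge_one_merge m₂']
  · rw [comp₂_one_split h₁ h₁' m₁, comp₂_one_merge h₂ m₂, h₁'.edge_one_merge m₁',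
      h₂'.edge_one_split m₂']
  · -- split merge / split merge
    rw [comp₂_one_split h₁ h₁' m₁, comp₂_one_split h₂ h₂' m₂, h₁'.edge_one_merge m₁',
      h₂'.edge_one_merge m₂']
    have a0 : r₃ p' u' := m₁'.join
    have a1 : r₃ p u := m₂'.join
    have a2 : r₃ p p' := by
      rcases (m₁.2 p' u').1 m₂.join with e | e | e
      · exact (m₁'.1 e).elim
      · exact r₃.symm (m₁'.le e.1)
      · exact r₃.trans (m₁'.le e.2) (r₃.symm a0)
    rw [mulX_congr a2, mulX_congr (r₃.trans (r₃.symm a1) a2), mulX_congr (r₃.symm a0)]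
  · rw [comp₂_one_split h₁ h₁' m₁, comp₂_one_split h₂ h₂' m₂, h₁'.edge_one_split m₁',
      h₂'.edge_one_split m₂']
    simp only [mulX_add]
    rw [mulX_comm p p', mulX_comm p u', mulX_comm u p', mulX_comm u u']
    abel

theorem comp₂_comm {r r₁ r₂ r₃ : Setoid A} {p u p' u' : A} {T₁ T₁' T₂ T₂' : A → Prop}
    (h₁ : Bif r r₁ p u T₁) (h₁' : Bif r₁ r₃ p' u' T₁') (h₂ : Bif r r₂ p' u' T₂)
    (h₂' : Bif r₂ r₃ p u T₂') (x : Quotient r → Bool) :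
    comp₂ (r := r) (r' := r₁) (r'' := r₃) T₁ T₁' x =
      comp₂ (r := r) (r' := r₂) (r'' := r₃) T₂ T₂' x := by
  induction hk : (Finset.univ.filter fun K => x K = false).card generalizing x with
  | zero =>
    have : x = fun _ => true := by
      funext K
      rw [Finset.card_eq_zero] at hk
      by_contra hK
      have : K ∈ (Finset.univ.filter fun K => x K = false) := by simpa using hK
      rw [hk] at this
      simp at this
    subst this
    exact comp₂_one_comm h₁ h₁' h₂ h₂'
  | succ k ih =>
    obtain ⟨K, hK⟩ : (Finset.univ.filter fun K => x K = false).Nonempty := by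
      rw [← Finset.card_pos]; omega
    have hxK : x K = false := by simpa using hK
    induction K using Quotient.inductionOn with | h a => ?_
    have e1 : x = Function.update (Function.update x (Quotient.mk r a) true)
        (Quotient.mk r a) false := by
      rw [Function.update_idem, ← hxK, Function.update_eq_self]
    rw [e1, comp₂_intertwine h₁ h₁' _ a (by simp), comp₂_intertwine h₂ h₂' _ a (by simp), ih]
    have : (Finset.univ.filter fun K => Function.update x (Quotient.mk r a) true K = false) =
        (Finset.univ.filter fun K => x K = false).erase (Quotient.mk r a) := by
      ext L
      by_cases hL : L = Quotient.mk r a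
      · subst hL; simp
      · simp [hL, Function.update_of_ne hL]
    rw [this, Finset.card_erase_of_mem hK, hk]
    rfl

end Frobenius

/-! ### Smoothings of planar projections -/

namespace Projection
variable {n : ℕ} (P : Projection n)

/-- Change the smoothing at `c`. -/
def flip (σ : Fin n → Bool) (c : Fin n) : Fin n → Bool := Function.update σ c (!σ c)

theorem flip_flip (σ : Fin n → Bool) (c : Fin n) : flip (flip σ c) c = σ := by
  simp [flip]

/-- The circles of the smoothing `σ`. -/
abbrev Circle (σ : Fin n → Bool) : Type := Quotient (P.conn σ)

/-- The strand `a` lies on a circle of the smoothing `σ` that passes by the double point `c`. -/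
def Touches (σ : Fin n → Bool) (c : Fin n) (a : P.Strand) : Prop :=
  ∃ s, P.conn σ a (P.inc c s) ∨ P.conn σ a (P.out c s)

theorem conn_of_join {σ : Fin n → Bool} {a b : P.Strand} (h : P.JoinRel σ a b) : P.conn σ a b :=
  Relation.EqvGen.rel _ _ h

theorem conn_le {σ : Fin n → Bool} (r : Setoid P.Strand) (h : ∀ a b, P.JoinRel σ a b → r a b)
    {a b : P.Strand} (hab : P.conn σ a b) : r a b := by
  replace hab : Relation.EqvGen (P.JoinRel σ) a b := hab
  induction hab with
  | rel x y e => exact h x y e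
  | refl x => exact r.refl x
  | symm x y _ ih => exact r.symm ih
  | trans x y z _ _ ih1 ih2 => exact r.trans ih1 ih2

theorem corner (σ : Fin n → Bool) (c : Fin n) :
    (P.conn σ (P.inc c .left) (P.out c .left) ∧ P.conn σ (P.inc c .right) (P.out c .right)) ∨
    (P.conn σ (P.inc c .left) (P.inc c .right) ∧ P.conn σ (P.out c .left) (P.out c .right)) := by
  cases h : σ c
  · exact .inl ⟨P.conn_of_join (.oriented c _ h), P.conn_of_join (.oriented c _ h)⟩
  · exact .inr ⟨P.conn_of_join (.lower c h), P.conn_of_join (.upper c h)⟩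

theorem touches_iff (σ : Fin n → Bool) (c : Fin n) (a : P.Strand) :
    P.Touches σ c a ↔ P.conn σ a (P.inc c .left) ∨ P.conn σ a (P.out c .right) := by
  constructor
  · rintro ⟨_ | _, h⟩
    · rcases P.corner σ c with ⟨h1, h2⟩ | ⟨h1, h2⟩
      · exact .inl (h.elim id fun h => (P.conn σ).trans h ((P.conn σ).symm h1))
      · exact h.imp id fun h => (P.conn σ).trans h h2
    · rcases P.corner σ c with ⟨h1, h2⟩ | ⟨h1, h2⟩
      · exact .inr (h.elim (fun h => (P.conn σ).trans h h2) id)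
      · exact h.imp (fun h => (P.conn σ).trans h ((P.conn σ).symm h1)) id
  · rintro (h | h)
    · exact ⟨_, .inl h⟩
    · exact ⟨_, .inr h⟩

/-- All four corners at `c` being related, the joins of the flipped smoothing are related. -/
theorem join_flip {σ : Fin n → Bool} {c : Fin n} (r : Setoid P.Strand)
    (hr : ∀ a b, P.conn σ a b → r a b) (h : r (P.inc c .left) (P.out c .right))
    (a b : P.Strand) (hab : P.JoinRel (flip σ c) a b) : r a b := by
  have key : ∀ s, r (P.inc c .left) (P.inc c s) ∧ r (P.inc c .left) (P.out c s) := by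
    rcases P.corner σ c with ⟨h1, h2⟩ | ⟨h1, h2⟩
    · rintro (_ | _)
      · exact ⟨r.refl _, hr _ _ h1⟩
      · exact ⟨r.trans h (r.symm (hr _ _ h2)), h⟩
    · rintro (_ | _)
      · exact ⟨r.refl _, r.trans h (r.symm (hr _ _ h2))⟩
      · exact ⟨hr _ _ h1, h⟩
  cases hab with
  | oriented c' s e =>
    by_cases hc : c' = c
    · subst hc; exact r.trans (r.symm (key s).1) (key s).2
    · exact hr _ _ (P.conn_of_join (.oriented c' s (by simpa [flip, hc] using e)))
  | lower c' e =>
    by_cases hc : c' = c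
    · subst hc; exact r.trans (r.symm (key _).1) (key _).1
    · exact hr _ _ (P.conn_of_join (.lower c' (by simpa [flip, hc] using e)))
  | upper c' e =>
    by_cases hc : c' = c
    · subst hc; exact r.trans (r.symm (key _).2) (key _).2
    · exact hr _ _ (P.conn_of_join (.upper c' (by simpa [flip, hc] using e)))

theorem merges_of {σ : Fin n → Bool} {c : Fin n}
    (h : ¬ P.conn σ (P.inc c .left) (P.out c .right))
    (h' : P.conn (flip σ c) (P.inc c .left) (P.out c .right)) :
    Merges (P.conn σ) (P.conn (flip σ c)) (P.inc c .left) (P.out c .right) := by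
  refine ⟨h, fun a b => ⟨?_, ?_⟩⟩
  · let r := P.conn σ
    let s : Setoid P.Strand :=
      { r := fun a b => r a b ∨ (r a (P.inc c .left) ∧ r (P.out c .right) b) ∨
          (r a (P.out c .right) ∧ r (P.inc c .left) b)
        iseqv := ⟨fun a => .inl (r.refl a), by
            rintro a b (e | e | e)
            · exact .inl (r.symm e)
            · exact .inr (.inr ⟨r.symm e.2, r.symm e.1⟩)
            · exact .inr (.inl ⟨r.symm e.2, r.symm e.1⟩), by
            rintro a b d (e | e | e) (f | f | f)
            · exact .inl (r.trans e f)
            · exact .inr (.inl ⟨r.trans e f.1, f.2⟩)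
            · exact .inr (.inr ⟨r.trans e f.1, f.2⟩)
            · exact .inr (.inl ⟨e.1, r.trans e.2 f⟩)
            · exact .inr (.inl ⟨e.1, f.2⟩)
            · exact .inl (r.trans e.1 f.2)
            · exact .inr (.inr ⟨e.1, r.trans e.2 f⟩)
            · exact .inl (r.trans e.1 f.2)
            · exact .inr (.inr ⟨e.1, f.2⟩)⟩ }
    exact fun e => P.conn_le s (P.join_flip s (fun a b => .inl) (.inr (.inl ⟨r.refl _, r.refl _⟩))) e
  · have hle : ∀ a b, P.conn σ a b → P.conn (flip σ c) a b := fun a b e =>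
      P.conn_le _ (fun x y exy => by
        have := P.join_flip (σ := flip σ c) (c := c) (P.conn (flip σ c)) (fun _ _ => id) h' x y
        rw [flip_flip] at this
        exact this exy) e
    rintro (e | e | e)
    · exact hle _ _ e
    · exact Setoid.trans' _ (hle _ _ e.1) (Setoid.trans' _ h' (hle _ _ e.2))
    · exact Setoid.trans' _ (hle _ _ e.1) (Setoid.trans' _ (Setoid.symm' _ h') (hle _ _ e.2))

theorem swap_not_sameCycle {α : Type*} [Finite α] [DecidableEq α] (π : Equiv.Perm α) {a b : α}
    (hab : a ≠ b) (h : π.SameCycle a b) : ¬ (π * Equiv.swap a b).SameCycle a b := by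
  have : Fintype α := Fintype.ofFinite α
  have hex : ∃ k : ℕ, 0 < k ∧ (π ^ k) a = b := by
    obtain ⟨i, hi, _, e⟩ := h.exists_pow_eq''
    exact ⟨i, hi, e⟩
  have hk := Nat.find_spec hex
  have hmin := fun i => Nat.find_min hex (m := i)
  set k := Nat.find hex
  have hna : ∀ i, 0 < i → i ≤ k → (π ^ i) a ≠ a := by
    intro i hi hik e
    rcases hik.eq_or_lt with rfl | hlt
    · exact hab (e.symm.trans hk.2)
    · refine hmin (k - i) (by omega) ⟨by omega, ?_⟩
      have h1 := hk.2
      rw [show k = (k - i) + i by omega, pow_add, Equiv.Perm.mul_apply, e] at h1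
      exact h1
  have step : ∀ m : ℕ, ∃ i, 0 < i ∧ i ≤ k ∧ ((π * Equiv.swap a b) ^ m) b = (π ^ i) a := by
    intro m
    induction m with
    | zero => exact ⟨k, hk.1, le_rfl, hk.2.symm⟩
    | succ m ih =>
      obtain ⟨i, hi, hik, e⟩ := ih
      rw [pow_succ', Equiv.Perm.mul_apply, e]
      rcases hik.eq_or_lt with rfl | hlt
      · exact ⟨1, by omega, hk.1, by rw [hk.2]; simp⟩
      · refine ⟨i + 1, by omega, by omega, ?_⟩
        rw [Equiv.Perm.mul_apply, Equiv.swap_apply_of_ne_of_ne (hna i hi hik)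
          (fun e => hmin i hlt ⟨hi, e⟩), pow_succ', Equiv.Perm.mul_apply]
  intro h'
  obtain ⟨m, _, _, e⟩ := h'.symm.exists_pow_eq''
  obtain ⟨i, hi, hik, e'⟩ := step m
  exact hna i hi hik (e'.symm.trans e)

theorem swap_sameCycle {α : Type*} [Finite α] [DecidableEq α] (π : Equiv.Perm α) {a b : α}
    (hab : a ≠ b) : π.SameCycle a b ↔ ¬ (π * Equiv.swap a b).SameCycle a b := by
  refine ⟨swap_not_sameCycle π hab, fun h => ?_⟩
  by_contra hn
  apply h
  have : Fintype α := Fintype.ofFinite α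
  have hex : ∃ k : ℕ, 0 < k ∧ (π ^ k) a = a := by
    obtain ⟨i, hi, _, e⟩ := (Equiv.Perm.SameCycle.refl π a).exists_pow_eq''
    exact ⟨i, hi, e⟩
  have hk := Nat.find_spec hex
  have hmin := fun i => Nat.find_min hex (m := i)
  set k := Nat.find hex
  have step : ∀ i, i < k → ((π * Equiv.swap a b) ^ (i + 1)) b = (π ^ (i + 1)) a := by
    intro i
    induction i with
    | zero => intro _; simp
    | succ i ih =>
      intro hi
      rw [pow_succ', Equiv.Perm.mul_apply, ih (by omega), Equiv.Perm.mul_apply,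
        Equiv.swap_apply_of_ne_of_ne (fun e => hmin (i + 1) hi ⟨by omega, e⟩)
          (fun e => hn ⟨(i + 1 : ℕ), by rw [zpow_natCast]; exact e⟩), ← Equiv.Perm.mul_apply,
        ← pow_succ']
  have := step (k - 1) (by omega)
  rw [show k - 1 + 1 = k by omega, hk.2] at this
  exact (show (π * Equiv.swap a b).SameCycle b a from ⟨(k : ℕ), by rw [zpow_natCast]; exact this⟩).symm

theorem conn_flip (hP : P.Planar) (σ : Fin n → Bool) (c : Fin n) :
    P.conn σ (P.inc c .left) (P.out c .right) ↔
      ¬ P.conn (flip σ c) (P.inc c .left) (P.out c .right) := by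
  obtain ⟨κ, hκ, hκ'⟩ := P.checkerboard hP
  have hκs : ∀ a, κ (P.next.symm a) = κ a := fun a => by
    rw [← hκ (P.next.symm a), Equiv.apply_symm_apply]
  have hz : ∀ x : ZMod 2, x = 0 ∨ x = 1 := by decide
  -- the arrival and departure points of an arc
  let arr : Fin n × Side → Fin n × Side := fun a => if κ a = 0 then P.next a else a
  let dep : Fin n × Side → Fin n × Side := fun a => if κ a = 0 then a else P.next a
  have karr : ∀ a, κ (arr a) = κ a := fun a => by simp only [arr]; split <;> simp [hκ]
  have kdep : ∀ a, κ (dep a) = κ a := fun a => by simp only [dep]; split <;> simp [hκ]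
  have iarr : Function.Injective arr := by
    intro a b h
    have h' := congrArg κ h
    rw [karr, karr] at h'
    simp only [arr, h'] at h
    split at h
    · exact P.next.injective h
    · exact h
  have idep : Function.Injective dep := by
    intro a b h
    have h' := congrArg κ h
    rw [kdep, kdep] at h'
    simp only [dep, h'] at h
    split at h
    · exact h
    · exact P.next.injective h
  let eA : Equiv.Perm (Fin n × Side) :=
    Equiv.ofBijective arr (Finite.injective_iff_bijective.1 iarr)
  let eD : Equiv.Perm (Fin n × Side) :=
    Equiv.ofBijective dep (Finite.injective_iff_bijective.1 idep)
  let op : Side → Side := fun s => match s with | .left => .right | .right => .left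
  have hop : ∀ s, op (op s) = s := by rintro (_ | _) <;> rfl
  let sw : (Fin n → Bool) → Equiv.Perm (Fin n × Side) := fun σ =>
    { toFun := fun x => if σ x.1 then (x.1, op x.2) else x
      invFun := fun x => if σ x.1 then (x.1, op x.2) else x
      left_inv := by rintro ⟨x, s⟩; by_cases h : σ x = true <;> simp [h, hop]
      right_inv := by rintro ⟨x, s⟩; by_cases h : σ x = true <;> simp [h, hop] }
  let π : (Fin n → Bool) → Equiv.Perm (Fin n × Side) := fun σ => eD⁻¹ * sw σ * eA
  have hA0 : ∀ x, κ x = 0 → eA⁻¹ x = P.next.symm x := fun x hx => by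
    rw [Equiv.Perm.inv_eq_iff_eq]
    change x = arr _
    simp [arr, hκs, hx]
  have hA1 : ∀ x, κ x = 1 → eA⁻¹ x = x := fun x hx => by
    rw [Equiv.Perm.inv_eq_iff_eq]
    change x = arr _
    simp [arr, hx]
  have hD0 : ∀ x, κ x = 0 → eD⁻¹ x = x := fun x hx => by
    rw [Equiv.Perm.inv_eq_iff_eq]
    change x = dep _
    simp [dep, hx]
  have hD1 : ∀ x, κ x = 1 → eD⁻¹ x = P.next.symm x := fun x hx => by
    rw [Equiv.Perm.inv_eq_iff_eq]
    change x = dep _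
    simp [dep, hκs, hx]
  have hπ : ∀ σ x, π σ (eA⁻¹ x) = eD⁻¹ (sw σ x) := fun σ x => by simp [π]
  -- circles are cycles
  have main : ∀ σ a b, P.conn σ (Sum.inl a) (Sum.inl b) ↔ (π σ).SameCycle a b := by
    intro σ a b
    constructor
    · intro h
      let r : Setoid P.Strand :=
        { r := fun x y => x = y ∨ ∃ a b, x = Sum.inl a ∧ y = Sum.inl b ∧ (π σ).SameCycle a b
          iseqv := ⟨fun _ => .inl rfl, by
            rintro x y (e | ⟨a, b, e1, e2, e3⟩)
            · exact .inl e.symm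
            · exact .inr ⟨b, a, e2, e1, e3.symm⟩, by
            rintro x y z (rfl | ⟨a, b, rfl, rfl, e3⟩) (rfl | ⟨a', b', e1, rfl, e3'⟩)
            · exact .inl rfl
            · exact .inr ⟨_, _, e1, rfl, e3'⟩
            · exact .inr ⟨_, _, rfl, rfl, e3⟩
            · cases e1
              exact .inr ⟨_, _, rfl, rfl, e3.trans e3'⟩⟩ }
      have hr : r (Sum.inl a) (Sum.inl b) := by
        refine P.conn_le r ?_ h
        intro x y hxy
        have one : ∀ u v, π σ u = v → (π σ).SameCycle u v := fun u v e => ⟨1, by simpa using e⟩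
        refine .inr ?_
        cases hxy with
        | oriented c s hs =>
          refine ⟨_, _, rfl, rfl, ?_⟩
          rcases hz (κ (c, s)) with h0 | h1
          · refine one _ _ ?_
            rw [← hA0 _ h0, hπ]
            simp [sw, hs, hD0 _ h0]
          · refine (one _ _ ?_).symm
            have := hπ σ (c, s)
            rw [hA1 _ h1] at this
            rw [this]
            simp [sw, hs, hD1 _ h1]
        | lower c hs =>
          refine ⟨_, _, rfl, rfl, ?_⟩
          rcases hz (κ (c, .left)) with h0 | h1
          · have h1 : κ (c, .right) = 1 := by rw [hκ', h0]; rfl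
            refine one _ _ ?_
            rw [← hA0 _ h0, hπ]
            simp [sw, hs, op, hD1 _ h1]
          · have h0 : κ (c, .right) = 0 := by rw [hκ', h1]; rfl
            refine (one _ _ ?_).symm
            rw [← hA0 _ h0, hπ]
            simp [sw, hs, op, hD1 _ h1]
        | upper c hs =>
          refine ⟨_, _, rfl, rfl, ?_⟩
          rcases hz (κ (c, .left)) with h0 | h1
          · have h1 : κ (c, .right) = 1 := by rw [hκ', h0]; rfl
            refine (one _ _ ?_).symm
            have := hπ σ (c, .right)
            rw [hA1 _ h1] at this
            rw [this]
            simp [sw, hs, op, hD0 _ h0]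
          · have h0 : κ (c, .right) = 0 := by rw [hκ', h1]; rfl
            refine one _ _ ?_
            have := hπ σ (c, .left)
            rw [hA1 _ h1] at this
            rw [this]
            simp [sw, hs, op, hD0 _ h0]
      rcases hr with e | ⟨a', b', e1, e2, e3⟩
      · cases e; exact .refl _ _
      · cases e1; cases e2; exact e3
    · intro h
      have : Fintype (Fin n × Side) := inferInstance
      have one : ∀ a, P.conn σ (Sum.inl a) (Sum.inl (π σ a)) := by
        intro a
        obtain ⟨⟨c, s⟩, rfl⟩ := (eA⁻¹).surjective a
        rw [hπ]
        have hs : σ c = true ∨ σ c = false := by cases σ c <;> simp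
        rcases hs with hs | hs
        · have e : sw σ (c, s) = (c, op s) := by simp [sw, hs]
          rw [e]
          have hκo : κ (c, op s) = κ (c, s) + 1 := by
            cases s
            · exact hκ' c
            · change κ (c, .left) = κ (c, .right) + 1
              rw [hκ']
              generalize κ _ = x
              revert x; decide
          rcases hz (κ (c, s)) with h0 | h1
          · rw [hA0 _ h0, hD1 _ (by rw [hκo, h0]; rfl)]
            cases s
            · exact P.conn_of_join (.lower c hs)
            · exact Setoid.symm' _ (P.conn_of_join (.lower c hs))
          · rw [hA1 _ h1, hD0 _ (by rw [hκo, h1]; rfl)]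
            cases s
            · exact P.conn_of_join (.upper c hs)
            · exact Setoid.symm' _ (P.conn_of_join (.upper c hs))
        · have e : sw σ (c, s) = (c, s) := by simp [sw, hs]
          rw [e]
          rcases hz (κ (c, s)) with h0 | h1
          · rw [hA0 _ h0, hD0 _ h0]
            exact P.conn_of_join (.oriented c s hs)
          · rw [hA1 _ h1, hD1 _ h1]
            exact Setoid.symm' _ (P.conn_of_join (.oriented c s hs))
      obtain ⟨m, hm1, hm2, rfl⟩ := h.exists_pow_eq''
      clear h hm1 hm2
      induction m with
      | zero => exact Setoid.refl' _ _
      | succ m ih =>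
        rw [pow_succ', Equiv.Perm.mul_apply]
        exact Setoid.trans' _ ih (one _)
  have hsw : sw (flip σ c) = sw σ * Equiv.swap (c, .left) (c, .right) := by
    ext1 ⟨x, s⟩
    by_cases hx : x = c
    · subst hx
      have hs : σ x = true ∨ σ x = false := by cases σ x <;> simp
      cases s <;> rcases hs with hs | hs <;> simp [sw, flip, op, hs]
    · have : Equiv.swap (c, Side.left) (c, Side.right) (x, s) = (x, s) := by
        apply Equiv.swap_apply_of_ne_of_ne <;> simp [hx]
      rw [Equiv.Perm.mul_apply, this]
      simp [sw, flip, hx]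
  have hflip : π (flip σ c) = π σ * Equiv.swap (eA⁻¹ (c, .left)) (eA⁻¹ (c, .right)) := by
    ext1 a
    obtain ⟨x, rfl⟩ := (eA⁻¹).surjective a
    rw [hπ, hsw, Equiv.Perm.mul_apply, Equiv.Perm.mul_apply, Equiv.swap_apply_apply,
      Equiv.Perm.mul_apply (eA⁻¹ * _), Equiv.Perm.mul_apply eA⁻¹,
      show (eA⁻¹)⁻¹ (eA⁻¹ x) = x by simp, hπ]
  have hne : eA⁻¹ (c, .left) ≠ eA⁻¹ (c, .right) := by simp
  have key := swap_sameCycle (π σ) hne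
  rw [← hflip, ← main, ← main] at key
  rcases hz (κ (c, .left)) with h0 | h1
  · have h1 : κ (c, .right) = 1 := by rw [hκ', h0]; rfl
    rw [hA0 _ h0, hA1 _ h1] at key
    exact key
  · have h0 : κ (c, .right) = 0 := by rw [hκ', h1]; rfl
    rw [hA1 _ h1, hA0 _ h0] at key
    have tr : ∀ σ, P.conn σ (P.inc c .left) (P.out c .right) ↔
        P.conn σ (P.out c .left) (P.inc c .right) := by
      intro σ
      rcases P.corner σ c with ⟨h1, h2⟩ | ⟨h1, h2⟩
      · exact ⟨fun h => Setoid.trans' _ (Setoid.symm' _ h1) (Setoid.trans' _ h (Setoid.symm' _ h2)),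
          fun h => Setoid.trans' _ h1 (Setoid.trans' _ h h2)⟩
      · exact ⟨fun h => Setoid.symm' _ (Setoid.trans' _ (Setoid.symm' _ h1)
          (Setoid.trans' _ h (Setoid.symm' _ h2))),
          fun h => Setoid.trans' _ h1 (Setoid.trans' _ (Setoid.symm' _ h) h2)⟩
    rw [tr, tr]
    exact key

theorem bifurcation (hP : P.Planar) (σ : Fin n → Bool) (c : Fin n) :
    Bif (P.conn σ) (P.conn (flip σ c)) (P.inc c .left) (P.out c .right) (P.Touches σ c) := by
  refine ⟨?_, P.touches_iff σ c⟩
  by_cases h : P.conn σ (P.inc c .left) (P.out c .right)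
  · refine .inr ?_
    have := P.merges_of (σ := flip σ c) (c := c) ((P.conn_flip hP σ c).1 h)
    rw [flip_flip] at this
    exact this h
  · exact .inl (P.merges_of h (by rwa [P.conn_flip hP, not_not] at h))

theorem touches_flip (hP : P.Planar) (σ : Fin n → Bool) (c : Fin n) (a : P.Strand) :
    P.Touches σ c a ↔ P.Touches (flip σ c) c a := by
  rw [(P.bifurcation hP σ c).touch', touches_iff]

/-- Basis vectors of the chain groups: a smoothing with a label `v₊` (`true`) or `v₋` (`false`) on each
of its circles. -/
abbrev EnhancedState : Type := Σ σ : Fin n → Bool, (P.Circle σ → Bool)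

end Projection

/-- A diagram of a singular oriented link with `n` transversal double points and no other crossings. -/
structure SingularLinkDiagram (n : ℕ) extends Projection n where
  planar : toProjection.Planar

/-- An oriented link diagram with `n` crossings: at each crossing, `overStrand` is the side from which
the upper strand comes in. -/
structure LinkDiagram (n : ℕ) extends SingularLinkDiagram n where
  overStrand : Fin n → Side

namespace LinkDiagram

variable {n : ℕ} (D : LinkDiagram n)

/-- A crossing is positive if its upper strand goes from the bottom left to the top right, otherwise
negative. -/
def isNegative (c : Fin n) : Bool := decide (D.overStrand c = .right)

/-- The planar smoothing `σ c` at the crossing `c` is the 0-resolution (`false`) or the 1-resolution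
(`true`) of the crossing: the oriented smoothing is the 0-resolution of a positive crossing and the
1-resolution of a negative one. -/
def resolution (σ : Fin n → Bool) (c : Fin n) : Bool := xor (σ c) (D.isNegative c)

/-- Number of 1-resolutions. -/
def numOnes (σ : Fin n → Bool) : ℕ :=
  (Finset.univ.filter fun c => D.resolution σ c = true).card

def numPositive : ℕ := (Finset.univ.filter fun c => D.isNegative c = false).card

def numNegative : ℕ := (Finset.univ.filter fun c => D.isNegative c = true).card

/-- Homological degree: number of 1-resolutions, minus the number of negative crossings. -/
def homDegree (v : D.EnhancedState) : ℤ := D.numOnes v.1 - D.numNegative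

/-- Quantum degree. -/
def qDegree (v : D.EnhancedState) : ℤ :=
  labelDegree v.2 + D.numOnes v.1 + D.numPositive - 2 * D.numNegative

/-- `(-1)` to the number of 1-resolved crossings before `c`. -/
def edgeSign (σ : Fin n → Bool) (c : Fin n) : ℤ :=
  ∏ k : Fin n, if k < c ∧ D.resolution σ k = true then -1 else 1

/-- Matrix coefficient of the Khovanov differential: the signed sum, over the 0-resolved crossings `c`,
of the merging or splitting maps for replacing the 0-resolution of `c` by its 1-resolution. -/
def incidence (v w : D.EnhancedState) : ℤ :=
  ∑ c : Fin n, if D.resolution v.1 c = false ∧ w.1 = Projection.flip v.1 c ∧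
    EdgeRel (D.Touches v.1 c) v.2 w.2 then D.edgeSign v.1 c else 0

/-- Generators of bidegree `(i, j)`. -/
abbrev Gen (i j : ℤ) : Type := {v : D.EnhancedState // D.homDegree v = i ∧ D.qDegree v = j}

/-- The Khovanov differential on the part of quantum degree `j`, from degree `i` to degree `i'`
(zero unless `i' = i + 1`). The free abelian group on `Gen i j` is written as functions. -/
def differential (i i' j : ℤ) : (D.Gen i j → ℤ) →ₗ[ℤ] (D.Gen i' j → ℤ) :=
  (Matrix.of fun (w : D.Gen i' j) (v : D.Gen i j) => D.incidence v.1 w.1).mulVecLin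

theorem resolution_flip (σ : Fin n → Bool) (c k : Fin n) :
    D.resolution (Projection.flip σ c) k = if k = c then !D.resolution σ k else D.resolution σ k := by
  unfold resolution Projection.flip
  by_cases h : k = c
  · subst h; simp
  · simp [h]

theorem numOnes_flip (σ : Fin n → Bool) (c : Fin n) (h : D.resolution σ c = false) :
    D.numOnes (Projection.flip σ c) = D.numOnes σ + 1 := by
  unfold numOnes
  have : (Finset.univ.filter fun k => D.resolution (Projection.flip σ c) k = true) =
      insert c (Finset.univ.filter fun k => D.resolution σ k = true) := by
    ext k
    simp only [Finset.mem_filter, Finset.mem_univ, true_and, Finset.mem_insert, resolution_flip]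
    by_cases hk : k = c
    · subst hk; simp [h]
    · simp [hk]
  rw [this, Finset.card_insert_of_notMem (by simp [h])]

theorem degrees_of_incidence {v w : D.EnhancedState} (h : D.incidence v w ≠ 0) :
    D.homDegree w = D.homDegree v + 1 ∧ D.qDegree w = D.qDegree v := by
  obtain ⟨c, -, hc⟩ := Finset.exists_ne_zero_of_sum_ne_zero h
  rw [ne_eq, ite_eq_right_iff, Classical.not_imp] at hc
  obtain ⟨⟨h1, h2, h3⟩, -⟩ := hc
  have e1 := D.numOnes_flip v.1 c h1
  rw [← h2] at e1
  have e2 := h3.2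
  unfold homDegree qDegree
  rw [e1, e2]
  push_cast
  constructor <;> ring

theorem edgeSign_flip (σ : Fin n → Bool) (c k : Fin n) (h : D.resolution σ c = false) :
    D.edgeSign (Projection.flip σ c) k = (if c < k then -1 else 1) * D.edgeSign σ k := by
  unfold edgeSign
  rw [← Finset.mul_prod_erase _ _ (Finset.mem_univ c),
    ← Finset.mul_prod_erase Finset.univ (fun l => if l < k ∧ D.resolution σ l = true then (-1 : ℤ) else 1)
      (Finset.mem_univ c), ← mul_assoc]
  congr 1
  · simp [resolution_flip, h]
  · refine Finset.prod_congr rfl fun l hl => ?_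
    rw [resolution_flip, if_neg (Finset.ne_of_mem_erase hl)]

theorem sum_edges (u w : D.EnhancedState) (c k : Fin n) :
    ∑ v : D.EnhancedState, (if v.1 = Projection.flip u.1 c ∧ EdgeRel (D.Touches u.1 c) u.2 v.2 then (1 : ℤ) else 0) *
      (if w.1 = Projection.flip v.1 k ∧ EdgeRel (D.Touches v.1 k) v.2 w.2 then (1 : ℤ) else 0) =
    if w.1 = Projection.flip (Projection.flip u.1 c) k then
      comp₂ (r' := D.conn (Projection.flip u.1 c)) (D.Touches u.1 c)
        (D.Touches (Projection.flip u.1 c) k) u.2 w.2 else 0 := by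
  rw [Fintype.sum_sigma, Finset.sum_eq_single (Projection.flip u.1 c)]
  · unfold comp₂ edge
    split_ifs with h <;> simp [h]
  · intro σ _ hσ
    simp [hσ]
  · simp

theorem flip_comm (σ : Fin n → Bool) (c k : Fin n) :
    Projection.flip (Projection.flip σ c) k = Projection.flip (Projection.flip σ k) c := by
  by_cases h : c = k
  · rw [h]
  · unfold Projection.flip
    rw [Function.update_of_ne h, Function.update_of_ne (Ne.symm h), Function.update_comm h]

theorem sum_edges_comm (u w : D.EnhancedState) (c k : Fin n) :
    ∑ v : D.EnhancedState, (if v.1 = Projection.flip u.1 c ∧ EdgeRel (D.Touches u.1 c) u.2 v.2 then (1 : ℤ) else 0) *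
      (if w.1 = Projection.flip v.1 k ∧ EdgeRel (D.Touches v.1 k) v.2 w.2 then (1 : ℤ) else 0) =
    ∑ v : D.EnhancedState, (if v.1 = Projection.flip u.1 k ∧ EdgeRel (D.Touches u.1 k) u.2 v.2 then (1 : ℤ) else 0) *
      (if w.1 = Projection.flip v.1 c ∧ EdgeRel (D.Touches v.1 c) v.2 w.2 then (1 : ℤ) else 0) := by
  rw [sum_edges, sum_edges, flip_comm u.1 k c]
  obtain ⟨σ', z⟩ := w
  by_cases h : σ' = Projection.flip (Projection.flip u.1 c) k
  · subst h
    rw [if_pos rfl, if_pos rfl]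
    have h' := D.bifurcation D.planar (Projection.flip u.1 k) c
    rw [← flip_comm] at h'
    exact congrFun (comp₂_comm (D.bifurcation D.planar u.1 c) (D.bifurcation D.planar _ k)
      (D.bifurcation D.planar u.1 k) h' u.2) z
  · rw [if_neg h, if_neg h]

theorem incidence_comp (u w : D.EnhancedState) :
    ∑ v : D.EnhancedState, D.incidence u v * D.incidence v w = 0 := by
  let m : Fin n → D.EnhancedState → D.EnhancedState → ℤ := fun c u v =>
    if v.1 = Projection.flip u.1 c ∧ EdgeRel (D.Touches u.1 c) u.2 v.2 then 1 else 0
  let a : (Fin n → Bool) → Fin n → ℤ := fun σ c =>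
    if D.resolution σ c = false then D.edgeSign σ c else 0
  have hinc : ∀ u v, D.incidence u v = ∑ c, a u.1 c * m c u v := by
    intro u v
    refine Finset.sum_congr rfl fun c _ => ?_
    simp only [a, m, mul_ite, mul_one, mul_zero]
    rw [← ite_and]
    congr 1
    rw [and_comm]
  have hm : ∀ c u v k, m c u v * a v.1 k = m c u v * a (Projection.flip u.1 c) k := by
    intro c u v k
    simp only [m]
    split_ifs with h
    · rw [h.1]
    · simp
  let F : Fin n → Fin n → ℤ := fun c k =>
    a u.1 c * a (Projection.flip u.1 c) k * ∑ v, m c u v * m k v w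
  have h1 : ∑ v : D.EnhancedState, D.incidence u v * D.incidence v w = ∑ c, ∑ k, F c k := by
    have e : ∀ v, D.incidence u v * D.incidence v w =
        ∑ c, ∑ k, a u.1 c * m c u v * (a v.1 k * m k v w) := fun v => by
      rw [hinc, hinc, Finset.sum_mul_sum]
    simp only [e, F, Finset.mul_sum]
    rw [Finset.sum_comm]
    refine Finset.sum_congr rfl fun c _ => ?_
    rw [Finset.sum_comm]
    refine Finset.sum_congr rfl fun k _ => Finset.sum_congr rfl fun v _ => ?_
    rw [show a u.1 c * m c u v * (a v.1 k * m k v w) = a u.1 c * (m c u v * a v.1 k) * m k v w by ring,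
      hm]
    ring
  have hF : ∀ c k, F c k = - F k c := by
    intro c k
    simp only [F, m, D.sum_edges_comm u w k c]
    rw [← neg_mul]
    congr 1
    simp only [a, D.resolution_flip]
    by_cases hck : c = k
    · subst hck
      cases h : D.resolution u.1 c <;> simp [h]
    · by_cases hc : D.resolution u.1 c = false
      · by_cases hk : D.resolution u.1 k = false
        · simp only [hc, hk, hck, Ne.symm hck, if_true, if_false, D.edgeSign_flip _ _ _ hc,
            D.edgeSign_flip _ _ _ hk]
          rcases lt_or_gt_of_ne hck with h | h
          · simp only [h, h.not_gt, if_true, if_false]; ring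
          · simp only [h, h.not_gt, if_true, if_false]; ring
        · simp [hck, Ne.symm hck, hk]
      · simp [hck, Ne.symm hck, hc]
  rw [h1]
  have h2 : ∑ c, ∑ k, F c k = - ∑ c, ∑ k, F c k := by
    conv_lhs => rw [Finset.sum_comm]
    rw [← Finset.sum_neg_distrib]
    refine Finset.sum_congr rfl fun c _ => ?_
    rw [← Finset.sum_neg_distrib]
    exact Finset.sum_congr rfl fun k _ => hF k c
  linarith

theorem sum_subtype_of_ne {α : Type*} [Fintype α] {p : α → Prop} [Fintype {x // p x}] (f : α → ℤ)
    (h : ∀ x, f x ≠ 0 → p x) : ∑ x : {x // p x}, f x.1 = ∑ x, f x := by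
  rw [← Finset.sum_subtype (Finset.univ.filter p) (fun x => by simp) f]
  exact Finset.sum_filter_of_ne fun x _ hx => h x hx

theorem differential_comp (i j : ℤ) :
    (D.differential (i + 1) (i + 1 + 1) j).comp (D.differential i (i + 1) j) = 0 := by
  unfold differential
  rw [← Matrix.mulVecLin_mul, ← Matrix.mulVecLin_zero]
  congr 1
  ext w u
  rw [Matrix.mul_apply, Matrix.zero_apply, ← D.incidence_comp u.1 w.1]
  simp only [Matrix.of_apply, mul_comm (D.incidence _ w.1)]
  refine sum_subtype_of_ne (fun v => D.incidence u.1 v * D.incidence v w.1) fun v hv => ?_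
  have := D.degrees_of_incidence (left_ne_zero_of_mul hv)
  rw [this.1, this.2, u.2.1, u.2.2]
  exact ⟨rfl, rfl⟩

theorem differential_eq_zero {i i' : ℤ} (j : ℤ) (h : i + 1 ≠ i') : D.differential i i' j = 0 := by
  unfold differential
  rw [← Matrix.mulVecLin_zero]
  congr 1
  ext w v
  rw [Matrix.of_apply, Matrix.zero_apply]
  by_contra hne
  have := (D.degrees_of_incidence hne).1
  rw [w.2.1, v.2.1] at this
  exact h this.symm

end LinkDiagram

/-- Bigraded complexes: a cochain complex of abelian groups for each quantum degree. -/
abbrev BigradedComplex : Type 1 := GradedObject ℤ (CochainComplex (ModuleCat.{0} ℤ) ℤ)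

/-- The Khovanov complex of a link diagram over `ℤ`. -/
def khovanovComplex {n : ℕ} (D : LinkDiagram n) : BigradedComplex := fun j =>
  { X := fun i => ModuleCat.of ℤ (D.Gen i j → ℤ)
    d := fun i i' => ModuleCat.ofHom (D.differential i i' j)
    shape := fun i i' h => by
      rw [D.differential_eq_zero j h]; rfl
    d_comp_d' := by
      rintro i _ _ rfl rfl
      rw [← ModuleCat.ofHom_comp, D.differential_comp]; rfl }

/-- The dual complex, `(C^*)^i = Hom(C^{-i}, ℤ)`, with the transposed differentials. -/
def dualComplex (C : CochainComplex (ModuleCat.{0} ℤ) ℤ) : CochainComplex (ModuleCat.{0} ℤ) ℤ where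
  X i := ModuleCat.of ℤ (Module.Dual ℤ (C.X (-i)))
  d i i' := ModuleCat.ofHom (C.d (-i') (-i)).hom.dualMap
  shape i i' h := by
    have h0 : C.d (-i') (-i) = 0 := C.shape _ _ fun e => h (by
      change -i' + 1 = -i at e
      change i + 1 = i'
      omega)
    rw [h0, ModuleCat.hom_zero]
    ext f x
    exact map_zero f
  d_comp_d' i i' i'' _ _ := by
    rw [← ModuleCat.ofHom_comp, LinearMap.dualMap_comp_dualMap, ← ModuleCat.hom_comp,
      C.d_comp_d, ModuleCat.hom_zero]
    ext f x
    exact map_zero f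

/-- The dual bigraded complex, `(C^*)^{i,j} = Hom(C^{-i,-j}, ℤ)`. -/
def BigradedComplex.dual (C : BigradedComplex) : BigradedComplex := fun j => dualComplex (C (-j))

/-- Shift of the quantum degree: degree `j` becomes degree `j + k`. -/
def BigradedComplex.qShift (k : ℤ) (C : BigradedComplex) : BigradedComplex := fun j => C (j - k)

/-- The mirror image in the plane of projection: the upper and lower strands are exchanged. -/
@[reducible] def LinkDiagram.mirror {n : ℕ} (D : LinkDiagram n) : LinkDiagram n where
  toSingularLinkDiagram := D.toSingularLinkDiagram
  overStrand c := match D.overStrand c with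
    | .left => .right
    | .right => .left

namespace SingularLinkDiagram

variable {n : ℕ} (S : SingularLinkDiagram n)

/-- The link diagrams at the vertices of the cube, i.e. in the `2^n` chambers adjacent to the
self-intersection of the discriminant given by `S`: the double points in `A` become negative
crossings (undercrossings), the others positive crossings (overcrossings). Adding a point to `A`
means crossing a wall of the discriminant in the direction of its coorientation, so that `∅` is the
first vertex and `Finset.univ` is the last one. -/
@[reducible] def resolve (A : Finset (Fin n)) : LinkDiagram n where
  toSingularLinkDiagram := S
  overStrand c := if c ∈ A then .right else .left

theorem isNegative_resolve (A : Finset (Fin n)) (c : Fin n) : (S.resolve A).isNegative c = decide (c ∈ A) := by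
  unfold LinkDiagram.isNegative resolve
  by_cases h : c ∈ A <;> simp [h]

theorem resolution_resolve (A : Finset (Fin n)) (σ : Fin n → Bool) (c : Fin n) :
    (S.resolve A).resolution σ c = xor (σ c) (decide (c ∈ A)) := by
  unfold LinkDiagram.resolution
  rw [isNegative_resolve]

/-- A sign for each basis vector, `-1` to the number of pairs `k < c` with `k ∈ A` and `c`
1-resolved. It changes the signs `edgeSign` of the differential into signs that depend on the planar
smoothing only. -/
def wallSign (A : Finset (Fin n)) (σ : Fin n → Bool) : ℤ :=
  ∏ c : Fin n, if (S.resolve A).resolution σ c = true then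
    ∏ k : Fin n, (if k < c ∧ k ∈ A then -1 else 1) else 1

/-- Matrix coefficient of the wall-crossing morphism for changing the crossings in `A' \ A`. On the
part where all these crossings are 0-resolved it is, up to sign, the identity onto the part where
they are 1-resolved (these are the same planar smoothings); on the rest it is zero. -/
def wallCoeff (A A' : Finset (Fin n)) (v w : S.EnhancedState) : ℤ :=
  if v = w ∧ ∀ c ∈ A' \ A, (S.resolve A).resolution v.1 c = false then
    S.wallSign A v.1 * S.wallSign A' w.1 else 0

/-- The wall-crossing morphism on the group of bidegree `(i, j)`. -/
def wallMap (A A' : Finset (Fin n)) (i j j' : ℤ) :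
    ((S.resolve A).Gen i j → ℤ) →ₗ[ℤ] ((S.resolve A').Gen i j' → ℤ) :=
  (Matrix.of fun (w : (S.resolve A').Gen i j') (v : (S.resolve A).Gen i j) =>
    S.wallCoeff A A' v.1 w.1).mulVecLin

theorem wallSign_mul_self (A : Finset (Fin n)) (σ : Fin n → Bool) :
    S.wallSign A σ * S.wallSign A σ = 1 := by
  unfold wallSign
  rw [← Finset.prod_mul_distrib]
  refine Finset.prod_eq_one fun c _ => ?_
  split
  · rw [← Finset.prod_mul_distrib]
    refine Finset.prod_eq_one fun k _ => ?_
    split <;> norm_num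
  · norm_num

/-- The corrected sign of the differential does not depend on `A`. -/
theorem wallSign_flip (A : Finset (Fin n)) (σ : Fin n → Bool) (c : Fin n)
    (h : (S.resolve A).resolution σ c = false) :
    S.wallSign A (Projection.flip σ c) * S.wallSign A σ * (S.resolve A).edgeSign σ c =
      ∏ k : Fin n, if k < c ∧ σ k = true then -1 else 1 := by
  have h1 : S.wallSign A (Projection.flip σ c) =
      (∏ k : Fin n, if k < c ∧ k ∈ A then -1 else 1) * S.wallSign A σ := by
    unfold wallSign
    rw [← Finset.mul_prod_erase _ _ (Finset.mem_univ c),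
      ← Finset.mul_prod_erase Finset.univ (fun c => if (S.resolve A).resolution σ c = true then
        ∏ k : Fin n, (if k < c ∧ k ∈ A then (-1 : ℤ) else 1) else 1) (Finset.mem_univ c),
      ← mul_assoc]
    congr 1
    · simp [LinkDiagram.resolution_flip, h]
    · refine Finset.prod_congr rfl fun l hl => ?_
      rw [LinkDiagram.resolution_flip, if_neg (Finset.ne_of_mem_erase hl)]
  rw [h1, mul_assoc _ (S.wallSign A σ) (S.wallSign A σ), wallSign_mul_self, mul_one]
  unfold LinkDiagram.edgeSign
  rw [← Finset.prod_mul_distrib]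
  refine Finset.prod_congr rfl fun k _ => ?_
  rw [resolution_resolve]
  by_cases hk : k < c <;> by_cases hA : k ∈ A <;> cases σ k <;> simp [hk, hA]

theorem wallCoeff_incidence (A A' : Finset (Fin n)) (hA : A ⊆ A') (v x : S.EnhancedState) :
    S.wallCoeff A A' x x * (S.resolve A).incidence v x =
      (S.resolve A').incidence v x * S.wallCoeff A A' v v := by
  unfold LinkDiagram.incidence
  rw [Finset.mul_sum, Finset.sum_mul]
  refine Finset.sum_congr rfl fun c _ => ?_
  by_cases hx : x.1 = Projection.flip v.1 c ∧ EdgeRel (S.Touches v.1 c) v.2 x.2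
  swap
  · have h1 : ¬ ((S.resolve A).resolution v.1 c = false ∧ x.1 = Projection.flip v.1 c ∧
        EdgeRel (S.Touches v.1 c) v.2 x.2) := fun h => hx h.2
    have h2 : ¬ ((S.resolve A').resolution v.1 c = false ∧ x.1 = Projection.flip v.1 c ∧
        EdgeRel (S.Touches v.1 c) v.2 x.2) := fun h => hx h.2
    rw [if_neg h1, if_neg h2, mul_zero, zero_mul]
  rw [if_congr (and_iff_left hx) rfl rfl, if_congr (and_iff_left hx) rfl rfl]
  unfold wallCoeff
  simp only [true_and]
  have hres : ∀ (B : Finset (Fin n)) k, (S.resolve B).resolution x.1 k =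
      if k = c then !(S.resolve B).resolution v.1 k else (S.resolve B).resolution v.1 k := by
    intro B k
    rw [hx.1, LinkDiagram.resolution_flip]
  by_cases hc : c ∈ A ↔ c ∈ A'
  · have e1 : (S.resolve A).resolution v.1 c = (S.resolve A').resolution v.1 c := by
      rw [resolution_resolve, resolution_resolve]; simp [hc]
    have e2 : (∀ k ∈ A' \ A, (S.resolve A).resolution x.1 k = false) ↔
        ∀ k ∈ A' \ A, (S.resolve A).resolution v.1 k = false := by
      refine forall₂_congr fun k hk => ?_
      rw [hres, if_neg]
      rintro rfl
      rw [Finset.mem_sdiff] at hk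
      tauto
    simp only [e2]
    rw [← e1]
    by_cases h0 : (S.resolve A).resolution v.1 c = false
    · rw [if_pos h0, if_pos h0]
      split
      · have f1 := S.wallSign_flip A v.1 c h0
        have f2 := S.wallSign_flip A' v.1 c (e1 ▸ h0)
        rw [← hx.1] at f1 f2
        have g1 := S.wallSign_mul_self A v.1
        have g2 := S.wallSign_mul_self A' x.1
        have f3 := f1.trans f2.symm
        linear_combination (S.wallSign A v.1 * S.wallSign A' x.1) * f3 -
          (S.wallSign A x.1 * S.wallSign A' x.1 * (S.resolve A).edgeSign v.1 c) * g1 +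
          (S.wallSign A v.1 * S.wallSign A' v.1 * (S.resolve A').edgeSign v.1 c) * g2
      · simp
    · rw [if_neg h0, if_neg h0]; simp
  · have hc' : c ∈ A' \ A := by have := @hA c; rw [Finset.mem_sdiff]; tauto
    have e1 : (S.resolve A').resolution v.1 c = !(S.resolve A).resolution v.1 c := by
      rw [resolution_resolve, resolution_resolve]
      rw [Finset.mem_sdiff] at hc'
      simp [hc'.1, hc'.2]
    have n1 : (S.resolve A).resolution v.1 c = false →
        ¬ ∀ k ∈ A' \ A, (S.resolve A).resolution x.1 k = false := by
      intro h h'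
      have := h' c hc'
      rw [hres, if_pos rfl, h] at this
      simp at this
    have n2 : (S.resolve A').resolution v.1 c = false →
        ¬ ∀ k ∈ A' \ A, (S.resolve A).resolution v.1 k = false := by
      intro h h'
      rw [e1, h' c hc'] at h
      simp at h
    by_cases h0 : (S.resolve A).resolution v.1 c = false
    · have h0' : ¬ (S.resolve A').resolution v.1 c = false := by rw [e1, h0]; simp
      rw [if_neg (n1 h0), if_neg h0', zero_mul, zero_mul]
    · have h0' : (S.resolve A').resolution v.1 c = false := by rw [e1]; simpa using h0
      rw [if_neg (n2 h0'), if_neg h0, mul_zero, mul_zero]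

theorem wallCoeff_eq_zero {A A' : Finset (Fin n)} {v w : S.EnhancedState} (h : v ≠ w) :
    S.wallCoeff A A' v w = 0 := if_neg fun e => h e.1

theorem numOnes_cast (A : Finset (Fin n)) (σ : Fin n → Bool) :
    ((S.resolve A).numOnes σ : ℤ) =
      ∑ c : Fin n, if (S.resolve A).resolution σ c = true then 1 else 0 := by
  unfold LinkDiagram.numOnes
  rw [Finset.card_filter]
  push_cast
  rfl

theorem numNegative_resolve (A : Finset (Fin n)) : (S.resolve A).numNegative = A.card := by
  unfold LinkDiagram.numNegative
  congr 1
  ext c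
  simp [isNegative_resolve]

theorem numPositive_resolve (A : Finset (Fin n)) :
    ((S.resolve A).numPositive : ℤ) = n - A.card := by
  unfold LinkDiagram.numPositive
  have : (Finset.univ.filter fun c => (S.resolve A).isNegative c = false) = Aᶜ := by
    ext c
    simp [isNegative_resolve]
  rw [this, Finset.card_compl, Fintype.card_fin, Nat.cast_sub]
  simpa using A.card_le_univ

theorem degrees_of_wallCoeff {A A' : Finset (Fin n)} (hA : A ⊆ A') {v w : S.EnhancedState}
    (h : S.wallCoeff A A' v w ≠ 0) :
    (S.resolve A').homDegree v = (S.resolve A).homDegree v ∧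
      (S.resolve A').qDegree v = (S.resolve A).qDegree v + 2 * A.card - 2 * A'.card := by
  have hz : ∀ c ∈ A' \ A, (S.resolve A).resolution v.1 c = false := by
    by_contra h'
    exact h (if_neg fun e => h' e.2)
  have e : ((S.resolve A').numOnes v.1 : ℤ) - (S.resolve A).numOnes v.1 = A'.card - A.card := by
    have hc : ∀ B : Finset (Fin n), (B.card : ℤ) = ∑ c : Fin n, if c ∈ B then 1 else 0 := by
      intro B; simp
    rw [numOnes_cast, numOnes_cast, hc, hc, ← Finset.sum_sub_distrib, ← Finset.sum_sub_distrib]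
    refine Finset.sum_congr rfl fun c _ => ?_
    have h1 := hz c
    have h2 := @hA c
    rw [Finset.mem_sdiff] at h1
    rw [resolution_resolve] at h1 ⊢
    rw [resolution_resolve]
    by_cases hc : c ∈ A <;> by_cases hc' : c ∈ A' <;> cases hv : v.1 c <;> simp_all
  unfold LinkDiagram.homDegree LinkDiagram.qDegree
  rw [numNegative_resolve, numNegative_resolve, numPositive_resolve, numPositive_resolve]
  constructor <;> linarith

theorem wallMap_comm {A A' : Finset (Fin n)} (hA : A ⊆ A') (i i' j j' : ℤ) :
    (S.wallMap A A' i' j j').comp ((S.resolve A).differential i i' j) =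
      ((S.resolve A').differential i i' j').comp (S.wallMap A A' i j j') := by
  unfold wallMap LinkDiagram.differential
  rw [← Matrix.mulVecLin_mul, ← Matrix.mulVecLin_mul]
  congr 1
  ext x v
  rw [Matrix.mul_apply, Matrix.mul_apply]
  simp only [Matrix.of_apply]
  have key := S.wallCoeff_incidence A A' hA v.1 x.1
  have e1 := LinkDiagram.sum_subtype_of_ne
    (p := fun y => (S.resolve A).homDegree y = i' ∧ (S.resolve A).qDegree y = j)
    (fun y => S.wallCoeff A A' y x.1 * (S.resolve A).incidence v.1 y) (by
      intro y hy
      have hyx : y = x.1 := by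
        by_contra h
        exact hy (by rw [S.wallCoeff_eq_zero h, zero_mul])
      subst hyx
      have d1 := (S.resolve A).degrees_of_incidence (right_ne_zero_of_mul hy)
      have hy' := hy
      rw [key] at hy'
      have d2 := (S.resolve A').degrees_of_incidence (left_ne_zero_of_mul hy')
      have d3 := S.degrees_of_wallCoeff hA (right_ne_zero_of_mul hy')
      have d4 := S.degrees_of_wallCoeff hA (left_ne_zero_of_mul hy)
      have := x.2
      have := v.2
      omega)
  have e2 := LinkDiagram.sum_subtype_of_ne
    (p := fun y => (S.resolve A').homDegree y = i ∧ (S.resolve A').qDegree y = j')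
    (fun y => (S.resolve A').incidence y x.1 * S.wallCoeff A A' v.1 y) (by
      intro y hy
      have hyx : v.1 = y := by
        by_contra h
        exact hy (by rw [S.wallCoeff_eq_zero h, mul_zero])
      subst hyx
      have d2 := (S.resolve A').degrees_of_incidence (left_ne_zero_of_mul hy)
      have hy' := hy
      rw [← key] at hy'
      have d1 := (S.resolve A).degrees_of_incidence (right_ne_zero_of_mul hy')
      have d3 := S.degrees_of_wallCoeff hA (right_ne_zero_of_mul hy)
      have d4 := S.degrees_of_wallCoeff hA (left_ne_zero_of_mul hy')
      have := x.2
      have := v.2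
      omega)
  refine e1.trans (Eq.trans ?_ e2.symm)
  rw [Finset.sum_eq_single x.1, Finset.sum_eq_single v.1, key]
  · intro y _ hy; rw [S.wallCoeff_eq_zero (Ne.symm hy), mul_zero]
  · simp
  · intro y _ hy; rw [S.wallCoeff_eq_zero hy, zero_mul]
  · simp

theorem wallMap_id (A : Finset (Fin n)) (i j : ℤ) : S.wallMap A A i j j = LinearMap.id := by
  unfold wallMap
  rw [← Matrix.mulVecLin_one]
  congr 1
  ext w v
  rw [Matrix.of_apply, Matrix.one_apply]
  unfold wallCoeff
  by_cases h : w = v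
  · subst h; simp [wallSign_mul_self]
  · rw [if_neg h, if_neg]
    exact fun e => h (Subtype.ext e.1.symm)

theorem wallCoeff_comp {A B C : Finset (Fin n)} (hAB : A ⊆ B) (hBC : B ⊆ C)
    (v : S.EnhancedState) :
    S.wallCoeff A C v v = S.wallCoeff B C v v * S.wallCoeff A B v v := by
  have key : (∀ c ∈ C \ A, (S.resolve A).resolution v.1 c = false) ↔
      (∀ c ∈ C \ B, (S.resolve B).resolution v.1 c = false) ∧
      (∀ c ∈ B \ A, (S.resolve A).resolution v.1 c = false) := by
    constructor
    · intro h
      refine ⟨fun c hc => ?_, fun c hc => h c ?_⟩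
      · rw [Finset.mem_sdiff] at hc
        have hcA : c ∉ A := fun e => hc.2 (hAB e)
        have := h c (by rw [Finset.mem_sdiff]; exact ⟨hc.1, hcA⟩)
        rw [resolution_resolve] at this ⊢
        simpa [hcA, hc.2] using this
      · rw [Finset.mem_sdiff] at hc ⊢
        exact ⟨hBC hc.1, hc.2⟩
    · rintro ⟨h1, h2⟩ c hc
      rw [Finset.mem_sdiff] at hc
      by_cases hcB : c ∈ B
      · exact h2 c (by rw [Finset.mem_sdiff]; exact ⟨hcB, hc.2⟩)
      · have := h1 c (by rw [Finset.mem_sdiff]; exact ⟨hc.1, hcB⟩)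
        rw [resolution_resolve] at this ⊢
        simpa [hcB, hc.2] using this
  unfold wallCoeff
  simp only [true_and, key]
  have h := S.wallSign_mul_self B v.1
  by_cases h1 : ∀ c ∈ C \ B, (S.resolve B).resolution v.1 c = false
  · by_cases h2 : ∀ c ∈ B \ A, (S.resolve A).resolution v.1 c = false
    · rw [if_pos ⟨h1, h2⟩, if_pos h1, if_pos h2]
      linear_combination -(S.wallSign A v.1 * S.wallSign C v.1) * h
    · rw [if_neg (fun e => h2 e.2), if_neg h2, mul_zero]
  · rw [if_neg (fun e => h1 e.1), if_neg h1, zero_mul]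

theorem wallMap_comp {A B C : Finset (Fin n)} (hAB : A ⊆ B) (hBC : B ⊆ C) (i j : ℤ) :
    (S.wallMap B C i (j - 2 * B.card) (j - 2 * C.card)).comp
      (S.wallMap A B i (j - 2 * A.card) (j - 2 * B.card)) =
    S.wallMap A C i (j - 2 * A.card) (j - 2 * C.card) := by
  unfold wallMap
  rw [← Matrix.mulVecLin_mul]
  congr 1
  ext x v
  rw [Matrix.mul_apply]
  simp only [Matrix.of_apply]
  have e := LinkDiagram.sum_subtype_of_ne
    (p := fun y => (S.resolve B).homDegree y = i ∧ (S.resolve B).qDegree y = j - 2 * B.card)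
    (fun y => S.wallCoeff B C y x.1 * S.wallCoeff A B v.1 y) (by
      intro y hy
      have hyx : v.1 = y := by
        by_contra h
        exact hy (by rw [S.wallCoeff_eq_zero h, mul_zero])
      subst hyx
      have d := S.degrees_of_wallCoeff hAB (right_ne_zero_of_mul hy)
      have := v.2
      omega)
  refine e.trans ?_
  by_cases h : v.1 = x.1
  · rw [Finset.sum_eq_single v.1, ← h, S.wallCoeff_comp hAB hBC]
    · intro y _ hy; rw [S.wallCoeff_eq_zero (A := A) (Ne.symm hy), mul_zero]
    · simp
  · rw [S.wallCoeff_eq_zero h]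
    refine Finset.sum_eq_zero fun y _ => ?_
    by_cases hy : v.1 = y
    · rw [S.wallCoeff_eq_zero (A := B) (fun e => h (hy.trans e)), zero_mul]
    · rw [S.wallCoeff_eq_zero (A := A) hy, mul_zero]

/-- The commutative `n`-dimensional cube of the Khovanov complexes of the diagrams `S.resolve A`,
with the wall-crossing morphisms. Changing a positive crossing to a negative one lowers the
quantum degree by `2`, so the complex at the vertex `A` is shifted by `2 * A.card`. -/
def khovanovCube : Finset (Fin n) ⥤ BigradedComplex where
  obj A := (khovanovComplex (S.resolve A)).qShift (2 * A.card)
  map {A A'} f := fun j =>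
    { f := fun i => ModuleCat.ofHom (S.wallMap A A' i (j - 2 * A.card) (j - 2 * A'.card))
      comm' := fun i i' _ => by
        change ModuleCat.ofHom _ ≫ ModuleCat.ofHom _ = ModuleCat.ofHom _ ≫ ModuleCat.ofHom _
        rw [← ModuleCat.ofHom_comp, ← ModuleCat.ofHom_comp, S.wallMap_comm f.le] }
  map_id A := by
    funext j
    refine HomologicalComplex.hom_ext _ _ fun i => ?_
    change ModuleCat.ofHom _ = _
    rw [wallMap_id]
    rfl
  map_comp {A B C} f g := by
    funext j
    refine HomologicalComplex.hom_ext _ _ fun i => ?_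
    change ModuleCat.ofHom _ = ModuleCat.ofHom _ ≫ ModuleCat.ofHom _
    rw [← ModuleCat.ofHom_comp, S.wallMap_comp f.le g.le]

end SingularLinkDiagram

end
end Khovanov

noncomputable section

open scoped Classical

namespace Khovanov

/-! A diagram `D` and its mirror image have the same flat projection, hence the same planar
smoothings, the same circles and the same basis vectors; only the names "0-resolution" and
"1-resolution" are exchanged at every crossing. Each edge of the cube of smoothings is therefore
traversed backwards, a merging becomes a splitting and conversely. The Frobenius algebra spanned by
`v₊` and `v₋` is self-dual: when `v₊` and `v₋` are taken as dual to each other, splitting is the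
transpose of merging. In terms of `EdgeRel` this is a symmetry of the definition. Agreement of
labels away from the touched circles is symmetric, and "the degree drops by one" survives if source
and target are interchanged and all labels are exchanged, because the exchange negates degrees
(`edgeRel_dualState`). So `dualState` carries the basis of `D` to a dual basis for the mirror image,
in the opposite bidegree (`homDegree_dualState`, `qDegree_dualState`), and it transposes the
differential up to signs.

The signs do not match on the nose. On the edge at the crossing `c` one differential counts the
1-resolved crossings before `c`, the other one the 0-resolved crossings before `c`; the two signs
differ by `(-1) ^ c`, which depends on the edge only through its direction `c`
(`edgeSign_mul_edgeSign_mirror`). Such a discrepancy is a coboundary on the cube: it is the change,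
along the edge, of the vertex function `positionSign`. Rescaling the basis by this function makes
the incidence matrices exactly transposed (`incidence_mirror`), and the resulting linear
isomorphisms commute with the differentials (`mirrorEquiv_differential`). This is the duality
`khovanovComplexMirror`.

The theorem follows since complementing `A` changes every crossing, so that `resolve_compl`
identifies the diagram at `Aᶜ` with a mirror image; `A = ∅` gives the first and the last vertex. The
bound on the length is independent of the duality: the number of 1-resolutions lies between `0` and
`n`, and it is shifted by the number of negative crossings. -/

theorem labelDegree_not {A : Type} [Finite A] {r : Setoid A} (x : Quotient r → Bool) :
    labelDegree (fun K => !x K) = -labelDegree x := by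
  unfold labelDegree
  rw [← Finset.sum_neg_distrib]
  have key : ∀ b : Bool, (if (!b) = true then (1 : ℤ) else -1) = -if b = true then 1 else -1 := by
    rintro (_ | _) <;> simp
  exact Finset.sum_congr rfl fun K _ => key (x K)

namespace LinkDiagram

variable {n : ℕ} (D : LinkDiagram n)

/-! ### Mirror images: resolutions and bidegrees. -/

theorem isNegative_mirror (c : Fin n) : D.mirror.isNegative c = !D.isNegative c := by
  unfold isNegative
  cases h : D.overStrand c <;> simp [h]

theorem resolution_mirror (σ : Fin n → Bool) (c : Fin n) :
    D.mirror.resolution σ c = !D.resolution σ c := by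
  unfold resolution
  rw [isNegative_mirror, Bool.xor_not]

theorem card_filter_add_card_filter_not (p : Fin n → Bool) :
    (Finset.univ.filter fun c => p c = true).card +
      (Finset.univ.filter fun c => p c = false).card = n := by
  have h := Finset.card_filter_add_card_filter_not (s := (Finset.univ : Finset (Fin n)))
    (fun c => p c = true)
  simpa using h

/-- Each crossing is 1-resolved for exactly one of the two diagrams. Besides the degree
computations, this supplies the bound `numOnes σ ≤ n` for the length of the complex. -/
theorem numOnes_mirror (σ : Fin n → Bool) : D.mirror.numOnes σ + D.numOnes σ = n := by
  unfold numOnes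
  simp only [resolution_mirror, Bool.not_eq_true']
  rw [add_comm, card_filter_add_card_filter_not]

theorem numNegative_mirror : D.mirror.numNegative = D.numPositive := by
  unfold numNegative numPositive
  simp only [isNegative_mirror, Bool.not_eq_true']

theorem numPositive_mirror : D.mirror.numPositive = D.numNegative := by
  unfold numNegative numPositive
  simp only [isNegative_mirror, Bool.not_eq_false']

theorem numNegative_add_numPositive : D.numNegative + D.numPositive = n :=
  card_filter_add_card_filter_not _

/-- The dual basis vector: the same smoothing, with the labels `v₊` and `v₋` exchanged. -/
def dualState (v : D.EnhancedState) : D.EnhancedState := ⟨v.1, fun K => !v.2 K⟩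

theorem dualState_dualState (v : D.EnhancedState) : D.dualState (D.dualState v) = v := by
  simp [dualState]

/-- Both terms are complemented in `n`: ones become `n` minus ones, negative crossings become `n`
minus negative crossings, and `n` cancels in the difference. -/
theorem homDegree_dualState (v : D.EnhancedState) :
    D.mirror.homDegree (D.dualState v) = -D.homDegree v := by
  have h1 := D.numOnes_mirror v.1
  have h2 := D.numNegative_add_numPositive
  unfold homDegree
  rw [numNegative_mirror]
  -- `dualState` keeps the smoothing, so the number of 1-resolutions is computed at `v.1`.
  change (D.mirror.numOnes v.1 : ℤ) - _ = _
  omega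

/-- The label degree is negated by the exchange of `v₊` and `v₋`. The remaining terms for the two
diagrams add up to `n - numNegative - numPositive = 0`. -/
theorem qDegree_dualState (v : D.EnhancedState) :
    D.mirror.qDegree (D.dualState v) = -D.qDegree v := by
  have h1 := D.numOnes_mirror v.1
  have h2 := D.numNegative_add_numPositive
  unfold qDegree
  rw [numNegative_mirror, numPositive_mirror]
  change labelDegree (fun K => !v.2 K) + (D.mirror.numOnes v.1 : ℤ) + _ - _ = _
  rw [labelDegree_not]
  omega

/-! ### Comparison of the edge signs. -/

/-- `-1` to the sum of the positions of the double points with `σ c = true`. -/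
def positionSign (σ : Fin n → Bool) : ℤ := ∏ c : Fin n, if σ c = true then (-1) ^ (c : ℕ) else 1

theorem positionSign_mul_self (σ : Fin n → Bool) : positionSign σ * positionSign σ = 1 := by
  unfold positionSign
  rw [← Finset.prod_mul_distrib]
  refine Finset.prod_eq_one fun c _ => ?_
  split
  · rw [← pow_add, Even.neg_one_pow ⟨_, rfl⟩]
  · norm_num

/-- This is the coboundary property for which `positionSign` is chosen: its change along an edge in
direction `c` is the ratio of the edge signs of `D` and of its mirror image. -/
theorem positionSign_flip (σ : Fin n → Bool) (c : Fin n) :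
    positionSign (Projection.flip σ c) = (-1) ^ (c : ℕ) * positionSign σ := by
  unfold positionSign
  rw [← Finset.mul_prod_erase _ _ (Finset.mem_univ c),
    ← Finset.mul_prod_erase Finset.univ (fun c : Fin n => if σ c = true then (-1 : ℤ) ^ (c : ℕ) else 1)
      (Finset.mem_univ c), ← mul_assoc]
  congr 1
  · have : ((-1 : ℤ) ^ (c : ℕ)) * (-1) ^ (c : ℕ) = 1 := by
      rw [← pow_add, Even.neg_one_pow ⟨_, rfl⟩]
    -- If `σ c` is `true`, the flip removes the factor `(-1) ^ c` instead of creating it; since its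
    -- square is `1`, removing and multiplying agree.
    cases h : σ c <;> simp [Projection.flip, h, this]
  · refine Finset.prod_congr rfl fun l hl => ?_
    rw [Projection.flip, Function.update_of_ne (Finset.ne_of_mem_erase hl)]

theorem edgeSign_mul_self (σ : Fin n → Bool) (c : Fin n) :
    D.edgeSign σ c * D.edgeSign σ c = 1 := by
  unfold edgeSign
  rw [← Finset.prod_mul_distrib]
  refine Finset.prod_eq_one fun k _ => ?_
  split <;> norm_num

/-- Each `k < c` is 1-resolved in exactly one of the two diagrams and so contributes one factor `-1`
to the product. As `Fin n` starts at `0`, there are `c` such `k`. -/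
theorem edgeSign_mul_edgeSign_mirror (σ : Fin n → Bool) (c : Fin n) :
    D.edgeSign σ c * D.mirror.edgeSign σ c = (-1) ^ (c : ℕ) := by
  unfold edgeSign
  rw [← Finset.prod_mul_distrib]
  have h : ∀ k : Fin n, (if k < c ∧ D.resolution σ k = true then (-1 : ℤ) else 1) *
      (if k < c ∧ D.mirror.resolution σ k = true then -1 else 1) = if k < c then -1 else 1 := by
    intro k
    rw [resolution_mirror]
    by_cases hk : k < c <;> cases D.resolution σ k <;> simp [hk]
  rw [Finset.prod_congr rfl fun k _ => h k, ← Finset.prod_filter, Finset.prod_const]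
  congr 1
  rw [Finset.filter_gt_eq_Iio, Fin.card_Iio]

/-! ### Transposition of the differential. -/

/-- The edges of the cube of smoothings are reversed by the mirror image. -/
theorem edgeRel_dualState {v w : D.EnhancedState} {c : Fin n}
    (h : w.1 = Projection.flip v.1 c) :
    EdgeRel (D.Touches w.1 c) (D.dualState w).2 (D.dualState v).2 ↔
      EdgeRel (D.Touches v.1 c) v.2 w.2 := by
  unfold EdgeRel
  change (∀ a, _ → (!w.2 _) = !v.2 _) ∧
    labelDegree (fun K => !v.2 K) = labelDegree (fun K => !w.2 K) - 1 ↔ _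
  rw [labelDegree_not, labelDegree_not]
  refine and_congr (forall_congr' fun a => ?_) (by constructor <;> intro <;> linarith)
  -- The strands on the circles passing by `c` are the same before and after the change of
  -- smoothing, so both relations ignore the same strands.
  have ht : D.Touches w.1 c a ↔ D.Touches v.1 c a := by rw [h, ← D.touches_flip D.planar]
  rw [ht]
  refine imp_congr_right fun _ => ?_
  rw [Bool.not_inj_iff]
  exact eq_comm

/-- After conjugation by `positionSign`, the matrix of the mirror image is the transpose of that of
`D`. The two sums are compared summand by summand: an edge from `v` to `w` at `c` for `D` is an edge
from `w` to `v` at the same `c` for the mirror image. -/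
theorem incidence_mirror (v w : D.EnhancedState) :
    positionSign v.1 * D.mirror.incidence (D.dualState w) (D.dualState v) =
      positionSign w.1 * D.incidence v w := by
  unfold incidence
  rw [Finset.mul_sum, Finset.mul_sum]
  refine Finset.sum_congr rfl fun c _ => ?_
  by_cases h : w.1 = Projection.flip v.1 c
  swap
  · have h' : ¬ v.1 = Projection.flip w.1 c := fun e => h (by rw [e, Projection.flip_flip])
    rw [if_neg fun e => h' e.2.1, if_neg fun e => h e.2.1, mul_zero, mul_zero]
  have h' : v.1 = Projection.flip w.1 c := by rw [h, Projection.flip_flip]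
  -- Two exchanges cancel, one from the mirror image and one from the flip at `c`; hence the
  -- mirrored edge also starts at a 0-resolution.
  have hres : D.mirror.resolution w.1 c = D.resolution v.1 c := by
    rw [resolution_mirror, h, resolution_flip, if_pos rfl, Bool.not_not]
  have hiff : (D.mirror.resolution (D.dualState w).1 c = false ∧
      (D.dualState v).1 = Projection.flip (D.dualState w).1 c ∧
      EdgeRel (D.mirror.Touches (D.dualState w).1 c) (D.dualState w).2 (D.dualState v).2) ↔
      (D.resolution v.1 c = false ∧ w.1 = Projection.flip v.1 c ∧
        EdgeRel (D.Touches v.1 c) v.2 w.2) := by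
    refine and_congr (by rw [← hres]; rfl) (and_congr (iff_of_true h' h) (D.edgeRel_dualState h))
  rw [if_congr hiff rfl rfl]
  split_ifs with hc
  swap
  · rw [mul_zero, mul_zero]
  -- The sign involves only crossings strictly before `c`, so it is the same at both ends of the
  -- edge.
  have e1 : D.edgeSign w.1 c = D.edgeSign v.1 c := by
    rw [h, D.edgeSign_flip _ _ _ hc.1, if_neg (lt_irrefl c), one_mul]
  have e2 := D.edgeSign_mul_edgeSign_mirror w.1 c
  have e3 := positionSign_flip v.1 c
  have e4 := D.edgeSign_mul_self v.1 c
  rw [← h] at e3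
  rw [e1] at e2
  change positionSign v.1 * D.mirror.edgeSign w.1 c = _
  rw [e3]
  -- With `e` and `e'` the edge signs of `D` and of the mirror image, `e * e' = (-1) ^ c` and `e * e
  -- = 1` give `e' = (-1) ^ c * e`.
  linear_combination (-positionSign v.1 * D.mirror.edgeSign w.1 c) * e4 +
    positionSign v.1 * D.edgeSign v.1 c * e2

/-! ### The isomorphism with the dual complex. -/

/-- Generators of the mirror image correspond to generators of the opposite bidegree. -/
def genMirror (i j : ℤ) : D.Gen (-i) (-j) ≃ D.mirror.Gen i j where
  toFun v := ⟨D.dualState v.1, by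
    rw [homDegree_dualState, qDegree_dualState, v.2.1, v.2.2, neg_neg, neg_neg]
    exact ⟨rfl, rfl⟩⟩
  invFun v := ⟨D.dualState v.1, by
    -- The degree formulas are applied to `dualState v`, whose dual is `v` again; this yields the
    -- degrees in `D` from those in the mirror image.
    have h1 := D.homDegree_dualState (D.dualState v.1)
    have h2 := D.qDegree_dualState (D.dualState v.1)
    rw [dualState_dualState] at h1 h2
    have := v.2
    omega⟩
  left_inv v := Subtype.ext (D.dualState_dualState v.1)
  right_inv v := Subtype.ext (D.dualState_dualState v.1)

/-- Multiplication of the basis vectors by the signs `positionSign`. -/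
def signEquiv (i j : ℤ) : (D.Gen i j → ℤ) ≃ₗ[ℤ] (D.Gen i j → ℤ) :=
  LinearEquiv.ofInvolutive
    { toFun := fun f v => positionSign v.1.1 * f v
      map_add' := fun f g => funext fun v => mul_add _ _ _
      map_smul' := fun a f => funext fun v => mul_left_comm _ _ _ }
    fun f => funext fun v => by
      change positionSign v.1.1 * (positionSign v.1.1 * f v) = f v
      rw [← mul_assoc, positionSign_mul_self, one_mul]

/-- The chain groups of the mirror image are the dual groups. -/
def mirrorEquiv (i j : ℤ) :
    (D.mirror.Gen i j → ℤ) ≃ₗ[ℤ] Module.Dual ℤ (D.Gen (-i) (-j) → ℤ) :=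
  -- Functions on the generators of the mirror image are pulled back to the generators of `D`,
  -- rescaled by signs, and turned into functionals by the dot product.
  (LinearEquiv.funCongrLeft ℤ ℤ (D.genMirror i j)).trans
    ((D.signEquiv (-i) (-j)).trans (dotProductEquiv ℤ (D.Gen (-i) (-j))))

theorem mirrorEquiv_apply (i j : ℤ) (f : D.mirror.Gen i j → ℤ) (g : D.Gen (-i) (-j) → ℤ) :
    D.mirrorEquiv i j f g =
      ∑ v, positionSign v.1.1 * f (D.genMirror i j v) * g v := rfl

theorem differential_apply (i i' j : ℤ) (f : D.Gen i j → ℤ) (w : D.Gen i' j) :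
    D.differential i i' j f w = ∑ v, D.incidence v.1 w.1 * f v := rfl

/-- Evaluated on `g`, both sides are double sums over the same pairs of generators, and
`incidence_mirror` matches them term by term. No relation between `i` and `i'` is needed. -/
theorem mirrorEquiv_differential (i i' j : ℤ) (f : D.mirror.Gen i j → ℤ) :
    D.mirrorEquiv i' j (D.mirror.differential i i' j f) =
      (D.differential (-i') (-i) (-j)).dualMap (D.mirrorEquiv i j f) := by
  refine LinearMap.ext fun g => ?_
  rw [LinearMap.dualMap_apply, mirrorEquiv_apply, mirrorEquiv_apply]
  simp only [differential_apply, Finset.mul_sum, Finset.sum_mul]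
  -- The generators of the mirror image are replaced by those of `D`, so that both sides have the
  -- same index sets in the same order.
  rw [Finset.sum_comm, ← (D.genMirror i j).sum_comp]
  refine Finset.sum_congr rfl fun w _ => Finset.sum_congr rfl fun v _ => ?_
  have h := D.incidence_mirror v.1 w.1
  change positionSign v.1.1 * (D.mirror.incidence (D.dualState w.1) (D.dualState v.1) * _) * g v = _
  linear_combination f (D.genMirror i j w) * g v * h

/-- The Khovanov complex of the mirror image is the dual complex. -/
def khovanovComplexMirror : khovanovComplex D.mirror ≅ (khovanovComplex D).dual :=
  GradedObject.isoMk _ _ fun j =>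
    HomologicalComplex.Hom.isoOfComponents (fun i => (D.mirrorEquiv i j).toModuleIso)
      fun i i' _ => by
        ext1
        exact LinearMap.ext fun f => (D.mirrorEquiv_differential i i' j f).symm

/-! ### Length of the complexes and passage to the cube. -/

theorem isZero_khovanovComplex {i : ℤ} (j : ℤ)
    (h : i < -(D.numNegative : ℤ) ∨ (n : ℤ) - D.numNegative < i) :
    Limits.IsZero ((khovanovComplex D j).X i) := by
  -- A generator in degree `i` would have `i + numNegative` 1-resolutions, a number between `0` and
  -- `n`.
  have : IsEmpty (D.Gen i j) := ⟨fun v => by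
    have h1 := v.2.1
    have h2 := D.numOnes_mirror v.1.1
    unfold homDegree at h1
    omega⟩
  exact ModuleCat.isZero_of_subsingleton (ModuleCat.of ℤ (D.Gen i j → ℤ))

end LinkDiagram

/-- The vertex at `∅` carries the formal shift `2 * card ∅`. Keeping it as a variable `l` with `l =
0` allows substitution; the degrees `-(j - k)` and `-(j - k) - 0` are then identified by `eqToIso`.
-/
theorem BigradedComplex.nonempty_iso_of_shift {C C' : BigradedComplex} (k l : ℤ) (hl : l = 0)
    (e : C ≅ C'.dual) : Nonempty (C.qShift k ≅ ((C'.qShift l).dual).qShift k) := by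
  subst hl
  refine ⟨GradedObject.isoMk _ _ fun j => ((GradedObject.eval (j - k)).mapIso e).trans
    (eqToIso ?_)⟩
  change dualComplex (C' (-(j - k))) = dualComplex (C' (-(j - k) - 0))
  rw [sub_zero]

/-- Both diagrams have the flat projection of `S`, and membership in `A` is negated exactly when the
upper strand is exchanged. An equality, rather than an isomorphism, lets statements about mirror
images be rewritten directly. -/
theorem SingularLinkDiagram.resolve_compl {n : ℕ} (S : SingularLinkDiagram n)
    (A : Finset (Fin n)) : S.resolve Aᶜ = (S.resolve A).mirror := by
  unfold resolve LinkDiagram.mirror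
  congr 1
  funext c
  by_cases h : c ∈ A <;> simp [h]

end Khovanov

end

/-! ### The theorem on the cube. -/

theorem proposition1 {n : ℕ} (S : Khovanov.SingularLinkDiagram n) :
    -- the vertices of the cube are complexes of length `n + 1`
    (∀ (A : Finset (Fin n)) (i j : ℤ), i < -(A.card : ℤ) ∨ (n : ℤ) - A.card < i →
      CategoryTheory.Limits.IsZero ((S.khovanovCube.obj A j).X i)) ∧
    -- the last complex of the cube is the dual of the first one
    Nonempty (Khovanov.khovanovComplex (S.resolve Finset.univ) ≅
      (Khovanov.khovanovComplex (S.resolve ∅)).dual) ∧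
    Nonempty (S.khovanovCube.obj Finset.univ ≅
      ((S.khovanovCube.obj ∅).dual).qShift (2 * n)) ∧
    -- changing all crossings gives the mirror image, exchanges the resolutions and dualizes
    (∀ A : Finset (Fin n),
      S.resolve Aᶜ = (S.resolve A).mirror ∧
      (∀ (σ : Fin n → Bool) (c : Fin n),
        (S.resolve Aᶜ).resolution σ c = !(S.resolve A).resolution σ c) ∧
      Nonempty (Khovanov.khovanovComplex (S.resolve Aᶜ) ≅
        (Khovanov.khovanovComplex (S.resolve A)).dual)) := by
  refine ⟨fun A i j h => ?_, ?_, ?_, fun A => ⟨S.resolve_compl A, fun σ c => ?_, ?_⟩⟩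
  · refine (S.resolve A).isZero_khovanovComplex _ ?_
    rwa [S.numNegative_resolve]
  -- The last vertex is the complement of the first one.
  · rw [← Finset.compl_empty, S.resolve_compl]
    exact ⟨(S.resolve ∅).khovanovComplexMirror⟩
  · have e : Khovanov.khovanovComplex (S.resolve Finset.univ) ≅
        (Khovanov.khovanovComplex (S.resolve ∅)).dual := by
      rw [← Finset.compl_empty, S.resolve_compl]
      exact (S.resolve ∅).khovanovComplexMirror
    have h := Khovanov.BigradedComplex.nonempty_iso_of_shift (2 * (n : ℤ))
      (2 * ((∅ : Finset (Fin n)).card : ℤ)) (by simp) e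
    have hn : (2 * ((Finset.univ : Finset (Fin n)).card : ℤ)) = 2 * n := by simp
    -- The shift at the last vertex is `2 * card univ`, which becomes `2 * n` only after rewriting.
    have hu : S.khovanovCube.obj Finset.univ =
        (Khovanov.khovanovComplex (S.resolve Finset.univ)).qShift (2 * (n : ℤ)) := by
      rw [← hn]
      rfl
    rw [hu]
    exact h
  · rw [S.resolve_compl, Khovanov.LinkDiagram.resolution_mirror]
  · rw [S.resolve_compl]
    exact ⟨(S.resolve A).khovanovComplexMirror⟩
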